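/- Let $(\mathcal S,\mathcal A,\mathcal R,P,\gamma)$ be a finite Markov decision process with deterministic rewards $\mathcal R(s,a)\in\mathbb R$, transition probabilities $P(s'|s,a)$, discount factor $\gamma\in(0,1)$ and $|\mathcal S||\mathcal A|\ge 2$. Let $Q^*$ be the unique fixed point of the Bellman optimality operator $\mathcal B(Q)(s,a)=\mathcal R(s,a)+\gamma\sum_{s'}P(s'|s,a)\max_{a'}Q(s',a')$. Let $\pi_b$ be a behavior policy with $\pi_b(a|s)>0$ for all $(s,a)$ such that the induced Markov chain $\{S_k\}$ on $\mathcal S$, with transition probabilities $\sum_a\pi_b(a|s)P(s'|s,a)$, is irreducible (it may be periodic). Let $\{Y_k\}_{k\ge0}=\{(S_k,A_k)\}_{k\ge 0}$ be a trajectory under $\pi_b$, i.e. a Markov chain on $\mathcal S\times\mathcal A$ with transition probabilities $P(s'|s,a)\pi_b(a'|s')$ and an arbitrary initial law. For step sizes $\alpha_k$ and a deterministic $Q_0\in\mathbb R^{\mathcal S\times\mathcal A}$ let $$Q_{k+1}(s,a)=Q_k(s,a)+\alpha_k\mathbf 1\{S_k=s,A_k=a\}\Big(\mathcal R(s,a)+\gamma\max_{a'}Q_k(S_{k+1},a')-Q_k(s,a)\Big).$$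 The state chain has a unique stationary distribution $\mu_b$, and $\Lambda_{\min}:=\min_{(s,a)}\mu_b(s)\pi_b(a|s)>0$. Fix any $y_0\in\mathcal S\times\mathcal A$; the expected hitting times of $y_0$ by the chain $\{Y_k\}$ are finite from every starting point, and $\tau_{y_0}$ denotes their maximum over starting points (the hitting time from $y_0$ itself is $0$). Put $$\eta_Q=(1-\gamma)\Lambda_{\min},\quad A_Q=25,\quad B_Q=9\|Q^*\|_\infty^2,\quad p=2\log(|\mathcal S||\mathcal A|),\quad \omega=\Big(\tfrac12+\tfrac1{2(1-\eta_Q)}\Big)^2-1,$$ $$\varrho_{Q,1}=\frac{2(1+\omega)}{\omega}(p-1)(|\mathcal S||\mathcal A|)^{2/p}\,4\tau_{y_0},\qquad \varrho_{Q,0}=\frac{2(1+\omega)(1+50\varrho_{Q,1})}{1+\omega/\sqrt e}\|Q_0-Q^*\|_\infty^2+36\|Q^*\|_\infty^2\varrho_{Q,1}.$$ Then $$0<\varrho_{Q,1}\le\frac{32e\,\tau_{y_0}\log(|\mathcal S||\mathcal A|)}{(1-\gamma)\Lambda_{\min}},\qquad \varrho_{Q,0}\le 4(1+50\varrho_{Q,1})\|Q_0-Q^*\|_\infty^2+36\|Q^*\|_\infty^2\varrho_{Q,1},$$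 and the following hold. (a) (Constant step size.) If $\alpha_k\equiv\alpha$ with $0<\alpha\le\min\{1,\frac{\eta_Q}{A_Q(5+2\eta_Q)\varrho_{Q,1}}\}$, then for all $k\ge0$ $$\mathbb E\|Q_{k+1}-Q^*\|_\infty^2\le\varrho_{Q,0}\exp\Big(\frac{-\eta_Q\alpha k}2\Big)+\frac{58B_Q\varrho_{Q,1}\alpha}{\eta_Q}.$$ (b) (Diminishing step size.) If $\alpha_k=\alpha/(k+K)$ with $\alpha>2/\eta_Q$ and real $K\ge\max\{A_Q\alpha(5\alpha+8)\varrho_{Q,1},2\}$, then for all $k\ge0$ $$\mathbb E\|Q_{k+1}-Q^*\|_\infty^2\le\varrho_{Q,0}\Big(\frac K{k+K}\Big)^{\eta_Q\alpha/2}+\frac{2B_Q\varrho_{Q,1}\alpha}{k+K}+\frac{72B_Q\varrho_{Q,1}e\alpha^2}{(\frac{\eta_Q\alpha}2-1)(k+K)}.$$ (c) (Sample complexity.) Let $r>0$ with $|\mathcal R(s,a)|\le r$ for all $(s,a)$, and let $0<\varepsilon\le\min\{\frac12,\frac r{1-\gamma}\}$. The constant step size $\alpha=\frac{\varepsilon^2\eta_Q(1-\gamma)^2}{1044\,r^2\varrho_{Q,1}}$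 satisfies the condition in (a), and with it $\mathbb E\|Q_k-Q^*\|_\infty^2\le\varepsilon^2$ and $\mathbb E\|Q_k-Q^*\|_\infty\le\varepsilon$ for every $$k\ge 10^6\,r^2\,\tau_{y_0}\log(|\mathcal S||\mathcal A|)\cdot\frac{\log(1/\varepsilon)+\log(1+\varrho_{Q,0})}{\varepsilon^2}\cdot\frac1{(1-\gamma)^5}\cdot\frac1{\Lambda_{\min}^3}.$$ If moreover $\varepsilon\varrho_{Q,0}\le1$, then the same holds for every $$k\ge 10^6\,r^2\,\tau_{y_0}\log(|\mathcal S||\mathcal A|)\cdot\frac{\log(1/\varepsilon)}{\varepsilon^2}\cdot\frac1{(1-\gamma)^5}\cdot\frac1{\Lambda_{\min}^3},$$ that is, as $\varepsilon\to0$ the sample complexity is $O(\log(1/\varepsilon)/\varepsilon^2)\cdot O((1-\gamma)^{-5})\cdot O(\Lambda_{\min}^{-3})$, without further logarithmic factors in $1/(1-\gamma)$ or $1/\Lambda_{\min}$; the hidden constant is the factor $10^6r^2\tau_{y_0}\log(|\mathcal S||\mathcal A|)$. -/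

import Mathlib

open MeasureTheory
open scoped ENNReal NNReal

noncomputable section

namespace QLearn

/-- A finite discounted Markov decision process: transition probabilities `trans s a s'`,
deterministic rewards `reward s a` and a discount factor in `(0, 1)`. -/
structure FiniteMDP (𝒮 𝒜 : Type*) [Fintype 𝒮] where
  trans : 𝒮 → 𝒜 → 𝒮 → ℝ
  trans_nonneg : ∀ s a s', 0 ≤ trans s a s'
  trans_sum : ∀ s a, ∑ s', trans s a s' = 1
  reward : 𝒮 → 𝒜 → ℝ
  disc : ℝ
  disc_pos : 0 < disc
  disc_lt_one : disc < 1

/-- A stationary randomized policy: `prob s a` is the probability of action `a` in state `s`. -/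
structure Policy (𝒮 𝒜 : Type*) [Fintype 𝒜] where
  prob : 𝒮 → 𝒜 → ℝ
  prob_nonneg : ∀ s a, 0 ≤ prob s a
  prob_sum : ∀ s, ∑ a, prob s a = 1

section

variable {𝒮 𝒜 : Type*} [Fintype 𝒮] [Fintype 𝒜]

/-- Transition matrix of the state chain `(S_k)` induced by a policy. -/
def stateChain (M : FiniteMDP 𝒮 𝒜) (b : Policy 𝒮 𝒜) : Matrix 𝒮 𝒮 ℝ :=
  fun s s' => ∑ a, b.prob s a * M.trans s a s'

/-- Transition probabilities of the state-action chain `Y_k = (S_k, A_k)`. -/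
def pairChain (M : FiniteMDP 𝒮 𝒜) (b : Policy 𝒮 𝒜) (y z : 𝒮 × 𝒜) : ℝ :=
  M.trans y.1 y.2 z.1 * b.prob z.1 z.2

/-- `μ` is a stationary distribution of the state chain. -/
structure IsStationary (M : FiniteMDP 𝒮 𝒜) (b : Policy 𝒮 𝒜) (μ : 𝒮 → ℝ) : Prop where
  nonneg : ∀ s, 0 ≤ μ s
  sum_one : ∑ s, μ s = 1
  invariant : ∀ s', ∑ s, μ s * stateChain M b s s' = μ s'

/-- `(S_k, A_k)` is a trajectory of the MDP under the policy `b`, with an arbitrary law of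
`(S_0, A_0)`: the finite-dimensional laws are those of the Markov chain with transition
probabilities `P(s' | s, a) b(a' | s')`. -/
structure IsTrajectory (M : FiniteMDP 𝒮 𝒜) (b : Policy 𝒮 𝒜) {Ω : Type*} [MeasurableSpace Ω]
    (P : Measure Ω) (S : ℕ → Ω → 𝒮) (A : ℕ → Ω → 𝒜) : Prop where
  measurableSet_state : ∀ k s, MeasurableSet {ω | S k ω = s}
  measurableSet_action : ∀ k a, MeasurableSet {ω | A k ω = a}
  path_law : ∀ (n : ℕ) (y : ℕ → 𝒮 × 𝒜),
    P.real {ω | ∀ i ≤ n, (S i ω, A i ω) = y i} =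
      P.real {ω | (S 0 ω, A 0 ω) = y 0} *
        ∏ i ∈ Finset.range n, pairChain M b (y i) (y (i + 1))

/-- `max_{a'} Q(s', a')`. -/
def maxQ [Nonempty 𝒜] (Q : 𝒮 × 𝒜 → ℝ) (s' : 𝒮) : ℝ :=
  Finset.univ.sup' Finset.univ_nonempty fun a' => Q (s', a')

/-- The Bellman optimality operator. -/
def bellman [Nonempty 𝒜] (M : FiniteMDP 𝒮 𝒜) (Q : 𝒮 × 𝒜 → ℝ) : 𝒮 × 𝒜 → ℝ :=
  fun y => M.reward y.1 y.2 + M.disc * ∑ s', M.trans y.1 y.2 s' * maxQ Q s'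

theorem abs_maxQ_sub_le [Nonempty 𝒜] (Q R : 𝒮 × 𝒜 → ℝ) (s : 𝒮) :
    |maxQ Q s - maxQ R s| ≤ ‖Q - R‖ := by
  have key : ∀ U V : 𝒮 × 𝒜 → ℝ, maxQ U s - maxQ V s ≤ ‖U - V‖ := by
    intro U V
    rw [sub_le_iff_le_add]
    refine Finset.sup'_le _ _ fun a _ => ?_
    have h1 : U (s, a) - V (s, a) ≤ ‖U - V‖ :=
      (le_abs_self _).trans (norm_le_pi_norm (U - V) (s, a))
    have h2 : V (s, a) ≤ maxQ V s :=
      Finset.le_sup' (fun a' => V (s, a')) (Finset.mem_univ a)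
    linarith
  rw [abs_le]
  constructor
  · have h := key R Q
    rw [norm_sub_rev] at h
    linarith
  · exact key Q R

theorem bellman_contracting [Nonempty 𝒜] (M : FiniteMDP 𝒮 𝒜) :
    ContractingWith ⟨M.disc, M.disc_pos.le⟩ (bellman M) := by
  refine ⟨by exact_mod_cast M.disc_lt_one, LipschitzWith.of_dist_le_mul fun Q R => ?_⟩
  rw [dist_eq_norm, dist_eq_norm]
  refine (pi_norm_le_iff_of_nonneg (mul_nonneg M.disc_pos.le (norm_nonneg _))).2 fun y => ?_
  have h : (bellman M Q - bellman M R) y =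
      M.disc * ∑ s', M.trans y.1 y.2 s' * (maxQ Q s' - maxQ R s') := by
    simp only [Pi.sub_apply, bellman, mul_sub, Finset.sum_sub_distrib]
    ring
  rw [h, Real.norm_eq_abs, abs_mul, abs_of_pos M.disc_pos]
  refine mul_le_mul_of_nonneg_left ?_ M.disc_pos.le
  calc |∑ s', M.trans y.1 y.2 s' * (maxQ Q s' - maxQ R s')|
      ≤ ∑ s', |M.trans y.1 y.2 s' * (maxQ Q s' - maxQ R s')| := Finset.abs_sum_le_sum_abs _ _
    _ ≤ ∑ s', M.trans y.1 y.2 s' * ‖Q - R‖ := by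
        refine Finset.sum_le_sum fun s' _ => ?_
        rw [abs_mul, abs_of_nonneg (M.trans_nonneg _ _ _)]
        exact mul_le_mul_of_nonneg_left (abs_maxQ_sub_le Q R s') (M.trans_nonneg _ _ _)
    _ = ‖Q - R‖ := by rw [← Finset.sum_mul, M.trans_sum, one_mul]

/-- The optimal `Q`-function: the fixed point of the Bellman optimality operator. -/
def Qstar [Nonempty 𝒜] (M : FiniteMDP 𝒮 𝒜) : 𝒮 × 𝒜 → ℝ :=
  (bellman_contracting M).fixedPoint

theorem bellman_Qstar [Nonempty 𝒜] (M : FiniteMDP 𝒮 𝒜) : bellman M (Qstar M) = Qstar M :=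
  (bellman_contracting M).fixedPoint_isFixedPt

theorem eq_Qstar [Nonempty 𝒜] (M : FiniteMDP 𝒮 𝒜) {Q : 𝒮 × 𝒜 → ℝ} (h : bellman M Q = Q) :
    Q = Qstar M :=
  (bellman_contracting M).fixedPoint_unique h

/-- The `Q`-learning iterates with step sizes `α`, started at `Q₀`, along the sample path
`(s, a)`. -/
def iterate [Nonempty 𝒜] [DecidableEq 𝒮] [DecidableEq 𝒜] (M : FiniteMDP 𝒮 𝒜) (α : ℕ → ℝ)
    (Q₀ : 𝒮 × 𝒜 → ℝ) (s : ℕ → 𝒮) (a : ℕ → 𝒜) : ℕ → 𝒮 × 𝒜 → ℝ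
  | 0 => Q₀
  | k + 1 => fun y =>
      iterate M α Q₀ s a k y +
        α k * (if s k = y.1 ∧ a k = y.2 then 1 else 0) *
          (M.reward y.1 y.2 + M.disc * maxQ (iterate M α Q₀ s a k) (s (k + 1)) -
            iterate M α Q₀ s a k y)

/-- `‖Q_k - Q*‖_∞` (the norm on a finite product of copies of `ℝ` is the sup norm). -/
def err [Nonempty 𝒜] [DecidableEq 𝒮] [DecidableEq 𝒜] (M : FiniteMDP 𝒮 𝒜) (α : ℕ → ℝ)
    (Q₀ : 𝒮 × 𝒜 → ℝ) {Ω : Type*} (S : ℕ → Ω → 𝒮) (A : ℕ → Ω → 𝒜) (k : ℕ) (ω : Ω) : ℝ :=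
  ‖iterate M α Q₀ (fun i => S i ω) (fun i => A i ω) k - Qstar M‖

/-- `P_y(Y_0 ≠ y₀, …, Y_n ≠ y₀)` for the state-action chain: the sum of the probabilities of the
paths of length `n` that start at `y` and avoid `y₀`. -/
def avoidProb [DecidableEq 𝒮] [DecidableEq 𝒜] (M : FiniteMDP 𝒮 𝒜) (b : Policy 𝒮 𝒜)
    (y₀ y : 𝒮 × 𝒜) (n : ℕ) : ℝ :=
  ∑ w : Fin (n + 1) → 𝒮 × 𝒜,
    if w 0 = y ∧ ∀ i, w i ≠ y₀ then ∏ i : Fin n, pairChain M b (w i.castSucc) (w i.succ) else 0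

/-- Expected hitting time `E_y[T]` of `y₀`, where `T = min {n ≥ 0 : Y_n = y₀}`, as
`∑_{n ≥ 0} P_y(T > n)`. -/
def expHitting [DecidableEq 𝒮] [DecidableEq 𝒜] (M : FiniteMDP 𝒮 𝒜) (b : Policy 𝒮 𝒜)
    (y₀ y : 𝒮 × 𝒜) : ℝ≥0∞ :=
  ∑' n : ℕ, ENNReal.ofReal (avoidProb M b y₀ y n)

/-- `τ_{y₀}`: the maximum over `y` of the expected hitting time of `y₀` from `y`. -/
def maxHitting [DecidableEq 𝒮] [DecidableEq 𝒜] [Nonempty 𝒮] [Nonempty 𝒜]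
    (M : FiniteMDP 𝒮 𝒜) (b : Policy 𝒮 𝒜) (y₀ : 𝒮 × 𝒜) : ℝ :=
  Finset.univ.sup' Finset.univ_nonempty fun y => (expHitting M b y₀ y).toReal

/-- `Λ_min = min_{(s,a)} μ(s) b(a | s)`. -/
def minOcc [Nonempty 𝒮] [Nonempty 𝒜] (b : Policy 𝒮 𝒜) (μ : 𝒮 → ℝ) : ℝ :=
  Finset.univ.inf' Finset.univ_nonempty fun y : 𝒮 × 𝒜 => μ y.1 * b.prob y.1 y.2

/-- `η_Q = (1 - γ) Λ_min`. -/
def eta [Nonempty 𝒮] [Nonempty 𝒜] (M : FiniteMDP 𝒮 𝒜) (b : Policy 𝒮 𝒜) (μ : 𝒮 → ℝ) : ℝ :=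
  (1 - M.disc) * minOcc b μ

/-- `ω = (1/2 + 1 / (2 (1 - η_Q)))² - 1`. -/
def omegaQ [Nonempty 𝒮] [Nonempty 𝒜] (M : FiniteMDP 𝒮 𝒜) (b : Policy 𝒮 𝒜) (μ : 𝒮 → ℝ) : ℝ :=
  (1 / 2 + 1 / (2 * (1 - eta M b μ))) ^ 2 - 1

/-- `|𝒮| |𝒜|` as a real number. -/
def numPairs (𝒮 𝒜 : Type*) [Fintype 𝒮] [Fintype 𝒜] : ℝ :=
  (Fintype.card 𝒮 : ℝ) * (Fintype.card 𝒜 : ℝ)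

/-- `p = 2 log (|𝒮| |𝒜|)`. -/
def pExp (𝒮 𝒜 : Type*) [Fintype 𝒮] [Fintype 𝒜] : ℝ :=
  2 * Real.log (numPairs 𝒮 𝒜)

/-- `A_Q = 25`. -/
def constA : ℝ := 25

/-- `B_Q = 9 ‖Q*‖²`. -/
def constB [Nonempty 𝒜] (M : FiniteMDP 𝒮 𝒜) : ℝ :=
  9 * ‖Qstar M‖ ^ 2

/-- `ϱ_{Q,1} = (2 (1 + ω) / ω) (p - 1) (|𝒮| |𝒜|)^{2/p} · 4 τ_{y₀}`. -/
def rho1 [DecidableEq 𝒮] [DecidableEq 𝒜] [Nonempty 𝒮] [Nonempty 𝒜]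
    (M : FiniteMDP 𝒮 𝒜) (b : Policy 𝒮 𝒜) (μ : 𝒮 → ℝ) (y₀ : 𝒮 × 𝒜) : ℝ :=
  2 * (1 + omegaQ M b μ) / omegaQ M b μ * (pExp 𝒮 𝒜 - 1) *
    numPairs 𝒮 𝒜 ^ (2 / pExp 𝒮 𝒜) * (4 * maxHitting M b y₀)

/-- `ϱ_{Q,0} = (2 (1 + ω)(1 + 50 ϱ_{Q,1}) / (1 + ω/√e)) ‖Q₀ - Q*‖² + 36 ‖Q*‖² ϱ_{Q,1}`. -/
def rho0 [DecidableEq 𝒮] [DecidableEq 𝒜] [Nonempty 𝒮] [Nonempty 𝒜]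
    (M : FiniteMDP 𝒮 𝒜) (b : Policy 𝒮 𝒜) (μ : 𝒮 → ℝ) (y₀ : 𝒮 × 𝒜) (Q₀ : 𝒮 × 𝒜 → ℝ) : ℝ :=
  2 * (1 + omegaQ M b μ) * (1 + 50 * rho1 M b μ y₀) /
      (1 + omegaQ M b μ / Real.sqrt (Real.exp 1)) * ‖Q₀ - Qstar M‖ ^ 2 +
    36 * ‖Qstar M‖ ^ 2 * rho1 M b μ y₀

/-- The constant step size used to reach accuracy `ε` when all rewards are bounded by `r`:
`ε² η_Q (1 - γ)² / (1044 r² ϱ_{Q,1})`. -/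
def accStep [DecidableEq 𝒮] [DecidableEq 𝒜] [Nonempty 𝒮] [Nonempty 𝒜]
    (M : FiniteMDP 𝒮 𝒜) (b : Policy 𝒮 𝒜) (μ : 𝒮 → ℝ) (y₀ : 𝒮 × 𝒜) (r ε : ℝ) : ℝ :=
  ε ^ 2 * eta M b μ * (1 - M.disc) ^ 2 / (1044 * r ^ 2 * rho1 M b μ y₀)

/-- `r² τ_{y₀} log(|𝒮||𝒜|) / (ε² (1 - γ)⁵ Λ_min³)`. -/
def sampleScale [DecidableEq 𝒮] [DecidableEq 𝒜] [Nonempty 𝒮] [Nonempty 𝒜]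
    (M : FiniteMDP 𝒮 𝒜) (b : Policy 𝒮 𝒜) (μ : 𝒮 → ℝ) (y₀ : 𝒮 × 𝒜) (r ε : ℝ) : ℝ :=
  r ^ 2 * maxHitting M b y₀ * Real.log (numPairs 𝒮 𝒜) /
    (ε ^ 2 * (1 - M.disc) ^ 5 * minOcc b μ ^ 3)

end

end QLearn

end

/-! The mean square error is controlled by a Lyapunov function corrected by a solution of a Poisson
equation, so neither mixing nor aperiodicity of the chain is needed.

The Lyapunov function is half the squared `ℓ_{2m}` norm of `Q - Q*`. With `m` about `log n / η`,
where `n` is the number of state-action pairs, this norm differs from the sup norm by a factor of at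
most `(1 - η/2)⁻¹`. Hence the stationary average of the update, a sup-norm contraction with factor
`1 - η`, still has drift `-η · lyap` (`sum_lyapGrad_mul_drift_le`). The gradient is Lipschitz with
constant `(4m - 3) n^(1/m)`, of order `log n / η` (`abs_lyapGrad_sub_le`,
`exists_lyapunov_exponent`).

The actual update touches only the current pair `y`, so the indicators `1{y = w}` stand where the
drift estimate wants `Λ w`. For each `w`, the difference is `v w - p (v w)` with `|v w| ≤ τ`
(`exists_poisson`): `v` compares the occupation of `w` before hitting `y₀` with its stationary share
of the hitting time. Adding `α ⟨∇lyap, v(·, y) (B(Q) - Q)⟩` to the Lyapunov function makes the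
first-order Markov noise cancel exactly in conditional expectation
(`sum_pairChain_mul_corrected_le`). The remaining errors are of order `α² ρ (‖Q - Q*‖² + ‖Q*‖²)`.
The part in `Q - Q*` is absorbed by the drift; the other part is the noise floor.

Since `Q*` is a zero of the residual, the correction itself is quadratic in `Q - Q*`. For small `α
ρ` the corrected function is therefore comparable to the uncorrected one, and its expectation obeys
an affine scalar recursion (`exists_lyapunov_recursion`), solved by `recursion_const` and
`recursion_dimin`. The exponent `p` and the quantity `ω` of the statement play no part in this
argument: all that matters is that `ϱ_{Q,1}` is at least `10 τ log n / η`, which dominates `τ` times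
the Lipschitz constant, and at most a constant multiple of the same quantity (`rho1_bounds`). -/

namespace QLearn

/-! ### The smooth Lyapunov function: half the squared `ℓ_{2m}` norm -/

section SmoothNorm

variable {ι : Type*} [Fintype ι]

/-- `∑ x_i ^ (2m)`. -/
noncomputable def powSum (m : ℕ) (x : ι → ℝ) : ℝ := ∑ i, x i ^ (2 * m)

/-- The `ℓ_{2m}` norm. -/
noncomputable def powNorm (m : ℕ) (x : ι → ℝ) : ℝ := powSum m x ^ (1 / (2 * m) : ℝ)

/-- Half of the squared `ℓ_{2m}` norm. -/
noncomputable def lyap (m : ℕ) (x : ι → ℝ) : ℝ := powNorm m x ^ 2 / 2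

/-- The gradient of `lyap m`. -/
noncomputable def lyapGrad (m : ℕ) (x : ι → ℝ) (i : ι) : ℝ :=
  x i ^ (2 * m - 1) / powNorm m x ^ (2 * m - 2)

/-- The ratio between the `ℓ_{2m}` norm and the sup norm. -/
noncomputable def rootCard (ι : Type*) [Fintype ι] (m : ℕ) : ℝ :=
  (Fintype.card ι : ℝ) ^ (1 / (2 * m) : ℝ)

theorem even_pow_nonneg (a : ℝ) (m : ℕ) : 0 ≤ a ^ (2 * m) := (even_two_mul m).pow_nonneg a

theorem powSum_nonneg (m : ℕ) (x : ι → ℝ) : 0 ≤ powSum m x :=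
  Finset.sum_nonneg fun _ _ => even_pow_nonneg _ _

theorem powNorm_nonneg (m : ℕ) (x : ι → ℝ) : 0 ≤ powNorm m x :=
  Real.rpow_nonneg (powSum_nonneg m x) _

theorem rootCard_nonneg (m : ℕ) : 0 ≤ rootCard ι m := Real.rpow_nonneg (Nat.cast_nonneg _) _

theorem powNorm_pow {m : ℕ} (hm : 0 < m) (x : ι → ℝ) : powNorm m x ^ (2 * m) = powSum m x := by
  have h : (2 * m : ℝ) ≠ 0 := by positivity
  rw [powNorm, ← Real.rpow_natCast, ← Real.rpow_mul (powSum_nonneg m x)]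
  push_cast
  rw [one_div_mul_cancel h, Real.rpow_one]

theorem rootCard_pow {m : ℕ} (hm : 0 < m) : rootCard ι m ^ (2 * m) = (Fintype.card ι : ℝ) := by
  have h : (2 * m : ℝ) ≠ 0 := by positivity
  rw [rootCard, ← Real.rpow_natCast, ← Real.rpow_mul (Nat.cast_nonneg _)]
  push_cast
  rw [one_div_mul_cancel h, Real.rpow_one]

theorem abs_le_powNorm {m : ℕ} (hm : 0 < m) (x : ι → ℝ) (i : ι) : |x i| ≤ powNorm m x := by
  refine le_of_pow_le_pow_left₀ (n := 2 * m) (by omega) (powNorm_nonneg m x) ?_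
  rw [powNorm_pow hm, (even_two_mul m).pow_abs]
  exact Finset.single_le_sum (f := fun i => x i ^ (2 * m)) (fun j _ => even_pow_nonneg _ _)
    (Finset.mem_univ i)

theorem norm_le_powNorm {m : ℕ} (hm : 0 < m) (x : ι → ℝ) : ‖x‖ ≤ powNorm m x :=
  (pi_norm_le_iff_of_nonneg (powNorm_nonneg m x)).2 fun i => abs_le_powNorm hm x i

theorem powNorm_le {m : ℕ} (hm : 0 < m) (x : ι → ℝ) : powNorm m x ≤ rootCard ι m * ‖x‖ := by
  refine le_of_pow_le_pow_left₀ (n := 2 * m) (by omega)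
    (mul_nonneg (rootCard_nonneg m) (norm_nonneg _)) ?_
  rw [powNorm_pow hm, mul_pow, rootCard_pow hm]
  calc powSum m x ≤ ∑ _i : ι, ‖x‖ ^ (2 * m) := by
        refine Finset.sum_le_sum fun i _ => ?_
        rw [← (even_two_mul m).pow_abs]
        exact pow_le_pow_left₀ (abs_nonneg _) (norm_le_pi_norm x i) _
    _ = _ := by simp

theorem powNorm_eq_zero {m : ℕ} (hm : 0 < m) {x : ι → ℝ} : powNorm m x = 0 ↔ x = 0 := by
  constructor
  · intro h
    have := norm_le_powNorm hm x
    rw [h] at this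
    exact norm_le_zero_iff.1 this
  · rintro rfl
    have := powNorm_le hm (0 : ι → ℝ)
    rw [norm_zero, mul_zero] at this
    exact le_antisymm this (powNorm_nonneg _ _)

/-- Hölder's inequality with exponents `2m/(2m-1)` and `2m`. -/
theorem sum_abs_pow_mul_le {m : ℕ} (hm : 0 < m) (x y : ι → ℝ) :
    ∑ i, |x i| ^ (2 * m - 1) * |y i| ≤ powNorm m x ^ (2 * m - 1) * powNorm m y := by
  have hm1 : (1 : ℝ) ≤ m := by exact_mod_cast hm
  have hc : ((2 * m - 1 : ℕ) : ℝ) = 2 * m - 1 := by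
    rw [Nat.cast_sub (by omega)]; push_cast; ring
  have h1 : (2 * m - 1 : ℝ) ≠ 0 := by linarith
  have h2 : (m : ℝ) ≠ 0 := by linarith
  have hpq : (2 * m / (2 * m - 1) : ℝ).HolderConjugate (2 * m) := by
    rw [Real.holderConjugate_iff]
    constructor
    · rw [lt_div_iff₀ (by linarith)]; linarith
    · field_simp; ring
  have h := Real.inner_le_Lp_mul_Lq_of_nonneg Finset.univ hpq
    (f := fun i => |x i| ^ (2 * m - 1)) (g := fun i => |y i|)
    (fun i _ => by positivity) (fun i _ => abs_nonneg _)
  refine h.trans (le_of_eq ?_)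
  congr 1
  · have e : ∀ i, (|x i| ^ (2 * m - 1)) ^ (2 * m / (2 * m - 1) : ℝ) = x i ^ (2 * m) := by
      intro i
      rw [← Real.rpow_natCast, ← Real.rpow_mul (abs_nonneg _), hc, mul_div_cancel₀ _ h1,
        ← (even_two_mul m).pow_abs, ← Real.rpow_natCast]
      norm_num
    simp_rw [e]
    rw [powNorm, ← Real.rpow_natCast, ← Real.rpow_mul (powSum_nonneg m x), hc]
    congr 1
    field_simp
  · rw [powNorm]
    congr 1
    refine Finset.sum_congr rfl fun i _ => ?_
    rw [← (even_two_mul m).pow_abs, ← Real.rpow_natCast]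
    norm_num

theorem powNorm_one (m : ℕ) : powNorm m (1 : ι → ℝ) = rootCard ι m := by
  simp [powNorm, powSum, rootCard]

theorem sum_abs_pow_le {m : ℕ} (hm : 0 < m) (x : ι → ℝ) :
    ∑ i, |x i| ^ (2 * m - 1) ≤ powNorm m x ^ (2 * m - 1) * rootCard ι m := by
  simpa [powNorm_one] using sum_abs_pow_mul_le hm x 1

/-- Hölder's inequality with exponents `m/(m-1)` and `m`. -/
theorem sum_pow_sub_two_le {m : ℕ} (hm : 2 ≤ m) (x : ι → ℝ) :
    ∑ i, x i ^ (2 * m - 2) ≤ powNorm m x ^ (2 * m - 2) * rootCard ι m ^ 2 := by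
  have hm1 : (2 : ℝ) ≤ m := by exact_mod_cast hm
  have hc : ((m - 1 : ℕ) : ℝ) = m - 1 := by
    rw [Nat.cast_sub (by omega)]; push_cast; ring
  have hc2 : ((2 * m - 2 : ℕ) : ℝ) = 2 * m - 2 := by
    rw [Nat.cast_sub (by omega)]; push_cast; ring
  have h1 : (m - 1 : ℝ) ≠ 0 := by linarith
  have h2 : (m : ℝ) ≠ 0 := by linarith
  have hpq : (m / (m - 1) : ℝ).HolderConjugate m := by
    rw [Real.holderConjugate_iff]
    constructor
    · rw [lt_div_iff₀ (by linarith)]; linarith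
    · field_simp; ring
  have h := Real.inner_le_Lp_mul_Lq_of_nonneg Finset.univ hpq
    (f := fun i => (x i ^ 2) ^ (m - 1)) (g := fun _ : ι => (1 : ℝ))
    (fun i _ => by positivity) (fun i _ => zero_le_one)
  have e0 : ∀ i, x i ^ (2 * m - 2) = (x i ^ 2) ^ (m - 1) * 1 := by
    intro i
    rw [← pow_mul, mul_one]
    congr 1
    omega
  simp_rw [e0]
  refine h.trans (le_of_eq ?_)
  congr 1
  · have e : ∀ i, ((x i ^ 2) ^ (m - 1)) ^ (m / (m - 1) : ℝ) = x i ^ (2 * m) := by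
      intro i
      rw [← Real.rpow_natCast, ← Real.rpow_mul (by positivity), hc, mul_div_cancel₀ _ h1,
        Real.rpow_natCast, ← pow_mul]
    simp_rw [e]
    rw [powNorm, ← Real.rpow_natCast, ← Real.rpow_mul (powSum_nonneg m x), hc2]
    congr 1
    field_simp
  · rw [rootCard, ← Real.rpow_natCast, ← Real.rpow_mul (Nat.cast_nonneg _)]
    simp

theorem powNorm_pow_sub_mul {m : ℕ} (hm : 2 ≤ m) (x : ι → ℝ) :
    powNorm m x ^ (2 * m - 1) = powNorm m x ^ (2 * m - 2) * powNorm m x := by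
  rw [← pow_succ]
  congr 1
  omega

/-- Hölder's inequality: the dual norm of the gradient is at most `powNorm m x`. At `x = 0` the
quotient defining the gradient is `0 / 0 = 0`, which is the correct gradient there. -/
theorem abs_sum_lyapGrad_mul_le_powNorm {m : ℕ} (hm : 2 ≤ m) (x w : ι → ℝ) :
    |∑ i, lyapGrad m x i * w i| ≤ powNorm m x * powNorm m w := by
  rcases (powNorm_nonneg m x).eq_or_lt with h0 | h0
  · have hx := (powNorm_eq_zero (by omega)).1 h0.symm
    have : ∀ i, lyapGrad m x i = 0 := by
      intro i
      simp [lyapGrad, hx, show 2 * m - 1 ≠ 0 by omega]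
    simp only [this, zero_mul, Finset.sum_const_zero, abs_zero]
    exact mul_nonneg (powNorm_nonneg _ _) (powNorm_nonneg _ _)
  · have hp : 0 < powNorm m x ^ (2 * m - 2) := by positivity
    have e : ∑ i, lyapGrad m x i * w i =
        (∑ i, x i ^ (2 * m - 1) * w i) / powNorm m x ^ (2 * m - 2) := by
      rw [Finset.sum_div]
      exact Finset.sum_congr rfl fun i _ => by rw [lyapGrad]; ring
    rw [e, abs_div, abs_of_pos hp, div_le_iff₀ hp]
    calc |∑ i, x i ^ (2 * m - 1) * w i| ≤ ∑ i, |x i ^ (2 * m - 1) * w i| :=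
          Finset.abs_sum_le_sum_abs _ _
      _ = ∑ i, |x i| ^ (2 * m - 1) * |w i| := by simp_rw [abs_mul, abs_pow]
      _ ≤ _ := sum_abs_pow_mul_le (by omega) x w
      _ = _ := by rw [powNorm_pow_sub_mul hm]; ring

theorem abs_sum_lyapGrad_mul_le {m : ℕ} (hm : 2 ≤ m) (x w : ι → ℝ) :
    |∑ i, lyapGrad m x i * w i| ≤ powNorm m x * (rootCard ι m * ‖w‖) :=
  (abs_sum_lyapGrad_mul_le_powNorm hm x w).trans
    (mul_le_mul_of_nonneg_left (powNorm_le (by omega) w) (powNorm_nonneg _ _))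

theorem abs_sum_lyapGrad_mul_le_norm {m : ℕ} (hm : 2 ≤ m) (x w : ι → ℝ) :
    |∑ i, lyapGrad m x i * w i| ≤ rootCard ι m ^ 2 * ‖x‖ * ‖w‖ := by
  refine (abs_sum_lyapGrad_mul_le hm x w).trans ?_
  have h1 := powNorm_le (m := m) (by omega) x
  have h2 : 0 ≤ rootCard ι m * ‖w‖ := mul_nonneg (rootCard_nonneg m) (norm_nonneg _)
  calc _ ≤ rootCard ι m * ‖x‖ * (rootCard ι m * ‖w‖) := mul_le_mul_of_nonneg_right h1 h2
    _ = _ := by ring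

theorem sum_lyapGrad_mul_self {m : ℕ} (hm : 2 ≤ m) (x : ι → ℝ) :
    ∑ i, lyapGrad m x i * x i = powNorm m x ^ 2 := by
  rcases (powNorm_nonneg m x).eq_or_lt with h0 | h0
  · have hx := (powNorm_eq_zero (by omega)).1 h0.symm
    rw [← h0]
    simp [hx]
  · have e : ∑ i, lyapGrad m x i * x i = powSum m x / powNorm m x ^ (2 * m - 2) := by
      rw [powSum, Finset.sum_div]
      refine Finset.sum_congr rfl fun i _ => ?_
      rw [lyapGrad, div_mul_eq_mul_div, ← pow_succ]
      congr 2
      omega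
    rw [e, ← powNorm_pow (by omega), div_eq_iff (by positivity), ← pow_add]
    congr 1
    omega

/-- Convexity without differentiating: Euler's identity at `x + v`, duality against `x`, and `2ab ≤
a² + b²`. The gradient is taken at the endpoint; moving it back to `x` is left to the Lipschitz
bound. -/
theorem lyap_add_le_grad {m : ℕ} (hm : 2 ≤ m) (x v : ι → ℝ) :
    lyap m (x + v) ≤ lyap m x + ∑ i, lyapGrad m (x + v) i * v i := by
  have h1 := sum_lyapGrad_mul_self hm (x + v)
  have h2 := (le_abs_self _).trans (abs_sum_lyapGrad_mul_le_powNorm hm (x + v) x)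
  have e : ∑ i, lyapGrad m (x + v) i * (x + v) i =
      ∑ i, lyapGrad m (x + v) i * x i + ∑ i, lyapGrad m (x + v) i * v i := by
    rw [← Finset.sum_add_distrib]
    exact Finset.sum_congr rfl fun i _ => by rw [Pi.add_apply]; ring
  rw [e] at h1
  unfold lyap
  nlinarith [sq_nonneg (powNorm m (x + v) - powNorm m x)]

theorem hasDerivAt_powSum_line {m : ℕ} (x v : ι → ℝ) (t : ℝ) :
    HasDerivAt (fun t : ℝ => powSum m (x + t • v))
      (∑ i, (2 * m : ℕ) * (x + t • v) i ^ (2 * m - 1) * v i) t := by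
  unfold powSum
  refine HasDerivAt.fun_sum fun i _ => ?_
  have h : HasDerivAt (fun t : ℝ => (x + t • v) i) (v i) t := by
    simpa using ((hasDerivAt_id t).mul_const (v i)).const_add (x i)
  exact h.pow (2 * m)

theorem lyapGrad_eq_rpow {m : ℕ} (hm : 2 ≤ m) (x : ι → ℝ) (i : ι) :
    lyapGrad m x i = x i ^ (2 * m - 1) * powSum m x ^ (1 / m - 1 : ℝ) := by
  have h2 : (m : ℝ) ≠ 0 := by positivity
  rw [lyapGrad, div_eq_mul_inv, powNorm, ← Real.rpow_natCast _ (2 * m - 2),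
    ← Real.rpow_mul (powSum_nonneg m x), ← Real.rpow_neg (powSum_nonneg m x),
    Nat.cast_sub (by omega)]
  congr 2
  push_cast
  field_simp
  ring

theorem abs_sum_pow_mul_le (x w : ι → ℝ) (k : ℕ) :
    |∑ i, x i ^ k * w i| ≤ (∑ i, |x i| ^ k) * ‖w‖ := by
  rw [Finset.sum_mul]
  refine (Finset.abs_sum_le_sum_abs _ _).trans (Finset.sum_le_sum fun i _ => ?_)
  rw [abs_mul, abs_pow]
  exact mul_le_mul_of_nonneg_left (norm_le_pi_norm w i) (by positivity)

/-- Lipschitz continuity of the gradient along a segment that avoids `0`. -/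
theorem abs_lyapGrad_sub_le_of_ne_zero {m : ℕ} (hm : 2 ≤ m) (x v w : ι → ℝ)
    (h0 : ∀ t ∈ Set.Icc (0 : ℝ) 1, x + t • v ≠ 0) :
    |∑ i, lyapGrad m (x + v) i * w i - ∑ i, lyapGrad m x i * w i| ≤
      (4 * m - 3) * rootCard ι m ^ 2 * ‖v‖ * ‖w‖ := by
  have hm1 : (2 : ℝ) ≤ m := by exact_mod_cast hm
  have hS : ∀ t ∈ Set.Icc (0 : ℝ) 1, 0 < powNorm m (x + t • v) := fun t ht =>
    lt_of_le_of_ne (powNorm_nonneg _ _) fun h => h0 t ht ((powNorm_eq_zero (by omega)).1 h.symm)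
  set ψ : ℝ → ℝ := fun t =>
    (∑ i, (x + t • v) i ^ (2 * m - 1) * w i) * powSum m (x + t • v) ^ (1 / m - 1 : ℝ) with hψ
  have eψ : ∀ t, ψ t = ∑ i, lyapGrad m (x + t • v) i * w i := by
    intro t
    rw [hψ]
    simp only
    rw [Finset.sum_mul]
    exact Finset.sum_congr rfl fun i _ => by rw [lyapGrad_eq_rpow hm]; ring
  have hd : ∀ t ∈ Set.Icc (0 : ℝ) 1, HasDerivWithinAt ψ
      ((∑ i, (2 * m - 1 : ℕ) * (x + t • v) i ^ (2 * m - 2) * v i * w i) *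
          powSum m (x + t • v) ^ (1 / m - 1 : ℝ) +
        (∑ i, (x + t • v) i ^ (2 * m - 1) * w i) *
          ((∑ i, (2 * m : ℕ) * (x + t • v) i ^ (2 * m - 1) * v i) * (1 / m - 1 : ℝ) *
            powSum m (x + t • v) ^ (1 / m - 1 - 1 : ℝ))) (Set.Icc 0 1) t := by
    intro t ht
    have hpos : powSum m (x + t • v) ≠ 0 := by
      rw [← powNorm_pow (by omega)]
      exact pow_ne_zero _ (hS t ht).ne'
    refine HasDerivAt.hasDerivWithinAt (HasDerivAt.mul ?_ ?_)
    · refine HasDerivAt.fun_sum fun i _ => ?_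
      have h : HasDerivAt (fun t : ℝ => (x + t • v) i) (v i) t := by
        simpa using ((hasDerivAt_id t).mul_const (v i)).const_add (x i)
      exact (h.pow (2 * m - 1)).mul_const (w i)
    · exact (hasDerivAt_powSum_line x v t).rpow_const (Or.inl hpos)
  have hb : ∀ t ∈ Set.Icc (0 : ℝ) 1,
      ‖(∑ i, (2 * m - 1 : ℕ) * (x + t • v) i ^ (2 * m - 2) * v i * w i) *
          powSum m (x + t • v) ^ (1 / m - 1 : ℝ) +
        (∑ i, (x + t • v) i ^ (2 * m - 1) * w i) *
          ((∑ i, (2 * m : ℕ) * (x + t • v) i ^ (2 * m - 1) * v i) * (1 / m - 1 : ℝ) *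
            powSum m (x + t • v) ^ (1 / m - 1 - 1 : ℝ))‖ ≤
      (4 * m - 3) * rootCard ι m ^ 2 * ‖v‖ * ‖w‖ := by
    intro t ht
    have hN := hS t ht
    generalize x + t • v = y at hN ⊢
    set N := powNorm m y with hNdef
    have hSN : powSum m y = N ^ (2 * m) := (powNorm_pow (by omega) y).symm
    have hSpos : 0 < powSum m y := by rw [hSN]; positivity
    have hm0 : (m : ℝ) ≠ 0 := by linarith
    -- The derivative of the gradient is homogeneous of degree 0, so all powers of `N` produced by
    -- Hölder's inequality cancel.
    have hr1 : powSum m y ^ (1 / m - 1 : ℝ) * N ^ (2 * m - 2) = 1 := by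
      rw [hNdef, powNorm, ← Real.rpow_natCast _ (2 * m - 2), ← Real.rpow_mul (powSum_nonneg m y),
        ← Real.rpow_add hSpos, Nat.cast_sub (by omega)]
      convert Real.rpow_zero _ using 2
      push_cast
      field_simp
      ring
    have hr2 : powSum m y ^ (1 / m - 1 - 1 : ℝ) * (N ^ (2 * m - 1) * N ^ (2 * m - 1)) = 1 := by
      rw [Real.rpow_sub_one hSpos.ne', div_mul_eq_mul_div, div_eq_iff hSpos.ne', one_mul]
      rw [show N ^ (2 * m - 1) * N ^ (2 * m - 1) = N ^ (2 * m - 2) * N ^ (2 * m) by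
        rw [← pow_add, ← pow_add]; congr 1; omega]
      rw [← mul_assoc, hr1, one_mul, hSN]
    have hA : 0 < powSum m y ^ (1 / m - 1 : ℝ) := Real.rpow_pos_of_pos hSpos _
    have hB : 0 < powSum m y ^ (1 / m - 1 - 1 : ℝ) := Real.rpow_pos_of_pos hSpos _
    have hv := norm_nonneg v
    have hw := norm_nonneg w
    have hk := rootCard_nonneg (ι := ι) m
    have b1 : |∑ i, (2 * m - 1 : ℕ) * y i ^ (2 * m - 2) * v i * w i| ≤
        (2 * m - 1) * (N ^ (2 * m - 2) * rootCard ι m ^ 2) * (‖v‖ * ‖w‖) := by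
      calc |∑ i, (2 * m - 1 : ℕ) * y i ^ (2 * m - 2) * v i * w i|
          ≤ ∑ i, (2 * m - 1) * y i ^ (2 * m - 2) * (‖v‖ * ‖w‖) := by
            refine (Finset.abs_sum_le_sum_abs _ _).trans (Finset.sum_le_sum fun i _ => ?_)
            have hev : 0 ≤ y i ^ (2 * m - 2) := by
              rw [show 2 * m - 2 = 2 * (m - 1) by omega]; exact even_pow_nonneg _ _
            have hc : ((2 * m - 1 : ℕ) : ℝ) = 2 * m - 1 := by
              rw [Nat.cast_sub (by omega)]; push_cast; ring
            rw [hc, mul_assoc (_ * _), abs_mul, abs_mul (v i), abs_of_nonneg (by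
              exact mul_nonneg (by linarith) hev)]
            refine mul_le_mul_of_nonneg_left ?_ (mul_nonneg (by linarith) hev)
            exact mul_le_mul (norm_le_pi_norm v i) (norm_le_pi_norm w i) (abs_nonneg _) hv
        _ = (2 * m - 1) * (∑ i, y i ^ (2 * m - 2)) * (‖v‖ * ‖w‖) := by
            rw [Finset.mul_sum, Finset.sum_mul]
        _ ≤ _ := by
            refine mul_le_mul_of_nonneg_right ?_ (mul_nonneg hv hw)
            exact mul_le_mul_of_nonneg_left (sum_pow_sub_two_le hm y) (by linarith)
    have b2 : ∀ u : ι → ℝ, |∑ i, y i ^ (2 * m - 1) * u i| ≤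
        N ^ (2 * m - 1) * rootCard ι m * ‖u‖ := fun u =>
      (abs_sum_pow_mul_le y u _).trans
        (mul_le_mul_of_nonneg_right (sum_abs_pow_le (by omega) y) (norm_nonneg _))
    have e3 : ∑ i, (2 * m : ℕ) * y i ^ (2 * m - 1) * v i =
        2 * m * ∑ i, y i ^ (2 * m - 1) * v i := by
      rw [Finset.mul_sum]
      exact Finset.sum_congr rfl fun i _ => by push_cast; ring
    rw [e3]
    -- The two terms of the product rule contribute `2m - 1` and `2m - 2`, which is where `4m - 3`
    -- comes from.
    have c1 : |(∑ i, (2 * m - 1 : ℕ) * y i ^ (2 * m - 2) * v i * w i) *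
        powSum m y ^ (1 / m - 1 : ℝ)| ≤ (2 * m - 1) * rootCard ι m ^ 2 * (‖v‖ * ‖w‖) := by
      rw [abs_mul, abs_of_pos hA]
      refine (mul_le_mul_of_nonneg_right b1 hA.le).trans (le_of_eq ?_)
      linear_combination (2 * m - 1) * rootCard ι m ^ 2 * (‖v‖ * ‖w‖) * hr1
    have c2 : |(∑ i, y i ^ (2 * m - 1) * w i) *
          (2 * m * (∑ i, y i ^ (2 * m - 1) * v i) * (1 / m - 1 : ℝ) *
            powSum m y ^ (1 / m - 1 - 1 : ℝ))| ≤
        (2 * m - 2) * rootCard ι m ^ 2 * (‖v‖ * ‖w‖) := by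
      have e4 : (∑ i, y i ^ (2 * m - 1) * w i) *
          (2 * m * (∑ i, y i ^ (2 * m - 1) * v i) * (1 / m - 1 : ℝ) *
            powSum m y ^ (1 / m - 1 - 1 : ℝ)) =
          -((2 * m - 2) * powSum m y ^ (1 / m - 1 - 1 : ℝ) *
            ((∑ i, y i ^ (2 * m - 1) * w i) * (∑ i, y i ^ (2 * m - 1) * v i))) := by
        field_simp
        ring
      have hnn : 0 ≤ (2 * m - 2) * powSum m y ^ (1 / m - 1 - 1 : ℝ) :=
        mul_nonneg (by linarith) hB.le
      rw [e4, abs_neg, abs_mul, abs_of_nonneg hnn, abs_mul]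
      refine (mul_le_mul_of_nonneg_left (mul_le_mul (b2 w) (b2 v) (abs_nonneg _)
        (by positivity)) hnn).trans (le_of_eq ?_)
      linear_combination (2 * m - 2) * rootCard ι m ^ 2 * (‖v‖ * ‖w‖) * hr2
    rw [Real.norm_eq_abs]
    refine (abs_add_le _ _).trans ((add_le_add c1 c2).trans (le_of_eq ?_))
    ring
  have h := Convex.norm_image_sub_le_of_norm_hasDerivWithin_le hd hb (convex_Icc 0 1)
    (Set.left_mem_Icc.2 zero_le_one) (Set.right_mem_Icc.2 zero_le_one)
  simpa [eψ] using h

/-- If the segment passes through `0`, then `‖x‖ + ‖x + v‖ = ‖v‖`, and bounding the two gradients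
separately is enough. -/
theorem abs_lyapGrad_sub_le {m : ℕ} (hm : 2 ≤ m) (x v w : ι → ℝ) :
    |∑ i, lyapGrad m (x + v) i * w i - ∑ i, lyapGrad m x i * w i| ≤
      (4 * m - 3) * rootCard ι m ^ 2 * ‖v‖ * ‖w‖ := by
  by_cases h0 : ∀ t ∈ Set.Icc (0 : ℝ) 1, x + t • v ≠ 0
  · exact abs_lyapGrad_sub_le_of_ne_zero hm x v w h0
  · push Not at h0
    obtain ⟨t, ht, h0⟩ := h0
    have hx : x = -(t • v) := eq_neg_of_add_eq_zero_left h0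
    have hxv : x + v = (1 - t) • v := by rw [hx]; module
    have n1 : ‖x‖ = t * ‖v‖ := by rw [hx, norm_neg, norm_smul, Real.norm_of_nonneg ht.1]
    have n2 : ‖x + v‖ = (1 - t) * ‖v‖ := by
      rw [hxv, norm_smul, Real.norm_of_nonneg (by linarith [ht.2])]
    have hm1 : (2 : ℝ) ≤ m := by exact_mod_cast hm
    have a1 := abs_sum_lyapGrad_mul_le_norm hm (x + v) w
    have a2 := abs_sum_lyapGrad_mul_le_norm hm x w
    rw [n2] at a1
    rw [n1] at a2
    have hp : 0 ≤ rootCard ι m ^ 2 * ‖v‖ * ‖w‖ := by positivity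
    calc _ ≤ |∑ i, lyapGrad m (x + v) i * w i| + |∑ i, lyapGrad m x i * w i| := abs_sub _ _
      _ ≤ rootCard ι m ^ 2 * ‖v‖ * ‖w‖ := by linarith
      _ ≤ (4 * m - 3) * (rootCard ι m ^ 2 * ‖v‖ * ‖w‖) :=
          le_mul_of_one_le_left hp (by linarith)
      _ = _ := by ring

theorem lyap_add_le {m : ℕ} (hm : 2 ≤ m) (x v : ι → ℝ) :
    lyap m (x + v) ≤ lyap m x + ∑ i, lyapGrad m x i * v i +
      (4 * m - 3) * rootCard ι m ^ 2 * ‖v‖ ^ 2 := by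
  have h1 := lyap_add_le_grad hm x v
  have h2 := (le_abs_self _).trans (abs_lyapGrad_sub_le hm x v v)
  nlinarith

theorem norm_sq_le_lyap {m : ℕ} (hm : 0 < m) (x : ι → ℝ) : ‖x‖ ^ 2 ≤ 2 * lyap m x := by
  have := pow_le_pow_left₀ (norm_nonneg x) (norm_le_powNorm hm x) 2
  unfold lyap
  linarith

theorem lyap_le_norm_sq {m : ℕ} (hm : 0 < m) (x : ι → ℝ) :
    2 * lyap m x ≤ rootCard ι m ^ 2 * ‖x‖ ^ 2 := by
  have := pow_le_pow_left₀ (powNorm_nonneg m x) (powNorm_le hm x) 2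
  unfold lyap
  rw [mul_pow] at this
  linarith

theorem lyap_nonneg (m : ℕ) (x : ι → ℝ) : 0 ≤ lyap m x := by
  unfold lyap
  positivity

end SmoothNorm

/-! ### Stationary distribution of an irreducible stochastic matrix -/

section Stationary

variable {ι : Type*} [Fintype ι]

/-- The entrywise absolute value of an invariant row vector of a stochastic matrix is invariant. -/
theorem abs_invariant {C : Matrix ι ι ℝ} (hC : ∀ i j, 0 ≤ C i j) (hC1 : ∀ i, ∑ j, C i j = 1)
    {v : ι → ℝ} (hv : ∀ j, ∑ i, v i * C i j = v j) (j : ι) :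
    ∑ i, |v i| * C i j = |v j| := by
  have hle : ∀ j ∈ Finset.univ, |v j| ≤ ∑ i, |v i| * C i j := by
    intro j _
    rw [← hv j]
    refine (Finset.abs_sum_le_sum_abs _ _).trans (le_of_eq ?_)
    exact Finset.sum_congr rfl fun i _ => by rw [abs_mul, abs_of_nonneg (hC i j)]
  have hsum : ∑ j, |v j| = ∑ j, ∑ i, |v i| * C i j := by
    rw [Finset.sum_comm]
    exact Finset.sum_congr rfl fun i _ => by rw [← Finset.mul_sum, hC1, mul_one]
  -- The triangle inequality holds entrywise and both sides have the same total, so it is an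
  -- equality in every entry.
  exact ((Finset.sum_eq_sum_iff_of_le hle).1 hsum j (Finset.mem_univ j)).symm

theorem invariant_pow [DecidableEq ι] {C : Matrix ι ι ℝ} {v : ι → ℝ} (hv : ∀ j, ∑ i, v i * C i j = v j) (k : ℕ)
    (j : ι) : ∑ i, v i * (C ^ k) i j = v j := by
  induction k generalizing j with
  | zero => simp [Matrix.one_apply]
  | succ k ih =>
    rw [pow_succ]
    simp only [Matrix.mul_apply, Finset.mul_sum]
    rw [Finset.sum_comm]
    simp_rw [← mul_assoc, ← Finset.sum_mul, ih]
    exact hv j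

/-- Some power of the matrix carries the mass at `i` to `j`, and the vector is invariant under that
power too. -/
theorem invariant_pos [DecidableEq ι] {C : Matrix ι ι ℝ} (hirr : C.IsIrreducible)
    {v : ι → ℝ} (hv : ∀ j, ∑ i, v i * C i j = v j) (h0 : ∀ i, 0 ≤ v i) {i : ι} (hi : 0 < v i)
    (j : ι) : 0 < v j := by
  obtain ⟨k, -, hk⟩ := (Matrix.isIrreducible_iff_exists_pow_pos hirr.nonneg).1 hirr i j
  rw [← invariant_pow hv k j]
  have hn : ∀ l ∈ Finset.univ, 0 ≤ v l * (C ^ k) l j := fun l _ =>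
    mul_nonneg (h0 l) (Matrix.pow_apply_nonneg hirr.nonneg k l j)
  exact lt_of_lt_of_le (mul_pos hi hk)
    (Finset.single_le_sum (f := fun l => v l * (C ^ k) l j) hn (Finset.mem_univ i))

/-- The constant vector is a right null vector of `C - 1`, so the determinant vanishes and a left
null vector exists. -/
theorem exists_invariant_ne_zero [DecidableEq ι] [Nonempty ι] {C : Matrix ι ι ℝ} (hC1 : ∀ i, ∑ j, C i j = 1) :
    ∃ v : ι → ℝ, v ≠ 0 ∧ ∀ j, ∑ i, v i * C i j = v j := by
  have hdet : (C - 1).det = 0 := by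
    refine Matrix.exists_mulVec_eq_zero_iff.1 ⟨1, one_ne_zero, ?_⟩
    funext i
    rw [Matrix.sub_mulVec, Matrix.one_mulVec]
    simp [Matrix.mulVec, dotProduct, hC1]
  obtain ⟨v, hv0, hv⟩ := Matrix.exists_vecMul_eq_zero_iff.2 hdet
  refine ⟨v, hv0, fun j => ?_⟩
  have h := congrFun hv j
  rw [Matrix.vecMul_sub, Matrix.vecMul_one] at h
  simpa [Matrix.vecMul, dotProduct, sub_eq_zero] using h

/-- Existence: normalize the absolute value of a nonzero invariant vector. Uniqueness: the
difference `d` of two solutions has sum zero, and `|d| + d` is again invariant. If `d` were positive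
somewhere, irreducibility would make it positive everywhere, contradicting the zero sum. -/
theorem existsUnique_invariant [DecidableEq ι] [Nonempty ι] {C : Matrix ι ι ℝ} (hirr : C.IsIrreducible)
    (hC1 : ∀ i, ∑ j, C i j = 1) :
    ∃! v : ι → ℝ, (∀ i, 0 ≤ v i) ∧ ∑ i, v i = 1 ∧ ∀ j, ∑ i, v i * C i j = v j := by
  have hC := hirr.nonneg
  obtain ⟨v, hv0, hv⟩ := exists_invariant_ne_zero hC1
  have habs := abs_invariant hC hC1 hv
  have hpos : 0 < ∑ i, |v i| := by
    obtain ⟨i, hi⟩ := Function.ne_iff.1 hv0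
    exact Finset.sum_pos' (fun _ _ => abs_nonneg _) ⟨i, Finset.mem_univ i, abs_pos.2 hi⟩
  refine ⟨fun i => |v i| / ∑ i, |v i|, ⟨fun i => by positivity, ?_, fun j => ?_⟩, ?_⟩
  · rw [← Finset.sum_div, div_self hpos.ne']
  · simp_rw [div_mul_eq_mul_div]
    rw [← Finset.sum_div, habs]
  · rintro μ ⟨hμ0, hμ1, hμ⟩
    set ν : ι → ℝ := fun i => |v i| / ∑ i, |v i| with hν
    have hν1 : ∑ i, ν i = 1 := by rw [hν, ← Finset.sum_div, div_self hpos.ne']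
    have hνinv : ∀ j, ∑ i, ν i * C i j = ν j := by
      intro j
      simp_rw [hν, div_mul_eq_mul_div]
      rw [← Finset.sum_div, habs]
    set d : ι → ℝ := fun i => μ i - ν i with hd
    have hdinv : ∀ j, ∑ i, d i * C i j = d j := by
      intro j
      simp_rw [hd, sub_mul]
      rw [Finset.sum_sub_distrib, hμ, hνinv]
    have hd0 : ∑ i, d i = 0 := by
      rw [hd, Finset.sum_sub_distrib, hμ1, hν1, sub_self]
    have hdabs := abs_invariant hC hC1 hdinv
    have hp : ∀ j, ∑ i, (|d i| + d i) * C i j = |d j| + d j := by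
      intro j
      simp_rw [add_mul]
      rw [Finset.sum_add_distrib, hdabs, hdinv]
    have hp0 : ∀ i, 0 ≤ |d i| + d i := fun i => by linarith [neg_abs_le (d i)]
    have hle : ∀ i, d i ≤ 0 := by
      by_contra! hex
      obtain ⟨i, hi⟩ := hex
      have hall : ∀ j, 0 < d j := by
        intro j
        have := invariant_pos hirr hp hp0 (i := i) (by linarith [le_abs_self (d i)]) j
        by_contra! hj
        rw [abs_of_nonpos hj] at this
        linarith
      have := Finset.sum_pos (fun j (_ : j ∈ Finset.univ) => hall j) Finset.univ_nonempty
      linarith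
    have hz := (Finset.sum_eq_zero_iff_of_nonpos (fun i _ => hle i)).1 hd0
    funext i
    have := hz i (Finset.mem_univ i)
    simp only [hd] at this
    linarith

end Stationary

/-! ### The state-action chain and its stationary law -/

section PairChain

variable {𝒮 𝒜 : Type*} [Fintype 𝒮] [Fintype 𝒜]

theorem stateChain_sum (M : FiniteMDP 𝒮 𝒜) (b : Policy 𝒮 𝒜) (s : 𝒮) :
    ∑ s', stateChain M b s s' = 1 := by
  unfold stateChain
  rw [Finset.sum_comm]
  simp_rw [← Finset.mul_sum, M.trans_sum, mul_one, b.prob_sum]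

theorem pairChain_nonneg (M : FiniteMDP 𝒮 𝒜) (b : Policy 𝒮 𝒜) (y z : 𝒮 × 𝒜) :
    0 ≤ pairChain M b y z := mul_nonneg (M.trans_nonneg _ _ _) (b.prob_nonneg _ _)

/-- Averaging a function of the next state over the state-action chain. -/
theorem sum_pairChain_mul_fst (M : FiniteMDP 𝒮 𝒜) (b : Policy 𝒮 𝒜) (y : 𝒮 × 𝒜) (f : 𝒮 → ℝ) :
    ∑ z, pairChain M b y z * f z.1 = ∑ s', M.trans y.1 y.2 s' * f s' := by
  rw [Fintype.sum_prod_type]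
  refine Finset.sum_congr rfl fun s' _ => ?_
  simp only [pairChain]
  calc ∑ a, M.trans y.1 y.2 s' * b.prob s' a * f s' =
        M.trans y.1 y.2 s' * f s' * ∑ a, b.prob s' a := by
          rw [Finset.mul_sum]; exact Finset.sum_congr rfl fun a _ => by ring
    _ = _ := by rw [b.prob_sum, mul_one]

theorem pairChain_sum (M : FiniteMDP 𝒮 𝒜) (b : Policy 𝒮 𝒜) (y : 𝒮 × 𝒜) :
    ∑ z, pairChain M b y z = 1 := by
  simpa [M.trans_sum] using sum_pairChain_mul_fst M b y fun _ => 1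

theorem existsUnique_isStationary [Nonempty 𝒮] [DecidableEq 𝒮] (M : FiniteMDP 𝒮 𝒜)
    (b : Policy 𝒮 𝒜) (hirr : (stateChain M b).IsIrreducible) :
    ∃! μ : 𝒮 → ℝ, IsStationary M b μ := by
  obtain ⟨μ, ⟨h0, h1, h2⟩, hu⟩ := existsUnique_invariant hirr (stateChain_sum M b)
  exact ⟨μ, ⟨h0, h1, h2⟩, fun ν hν => hu ν ⟨hν.nonneg, hν.sum_one, hν.invariant⟩⟩

theorem IsStationary.pos [DecidableEq 𝒮] {M : FiniteMDP 𝒮 𝒜} {b : Policy 𝒮 𝒜} {μ : 𝒮 → ℝ}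
    (hirr : (stateChain M b).IsIrreducible) (h : IsStationary M b μ) (s : 𝒮) : 0 < μ s := by
  obtain ⟨i, -, hi⟩ : ∃ i ∈ Finset.univ, 0 < μ i :=
    (Finset.sum_pos_iff_of_nonneg fun i _ => h.nonneg i).1 (by rw [h.sum_one]; exact one_pos)
  exact invariant_pos hirr h.invariant h.nonneg hi s

/-- The stationary law of the state-action chain. -/
def occ (b : Policy 𝒮 𝒜) (μ : 𝒮 → ℝ) (y : 𝒮 × 𝒜) : ℝ := μ y.1 * b.prob y.1 y.2

theorem sum_occ {M : FiniteMDP 𝒮 𝒜} {b : Policy 𝒮 𝒜} {μ : 𝒮 → ℝ} (h : IsStationary M b μ) :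
    ∑ y, occ b μ y = 1 := by
  rw [Fintype.sum_prod_type]
  simp_rw [occ, ← Finset.mul_sum, b.prob_sum, mul_one, h.sum_one]

theorem occ_invariant {M : FiniteMDP 𝒮 𝒜} {b : Policy 𝒮 𝒜} {μ : 𝒮 → ℝ} (h : IsStationary M b μ)
    (z : 𝒮 × 𝒜) : ∑ y, occ b μ y * pairChain M b y z = occ b μ z := by
  rw [Fintype.sum_prod_type, occ, ← h.invariant z.1, Finset.sum_mul]
  refine Finset.sum_congr rfl fun s _ => ?_
  simp only [occ, pairChain, stateChain]
  rw [Finset.mul_sum, Finset.sum_mul]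
  exact Finset.sum_congr rfl fun a _ => by ring

theorem minOcc_le_occ [Nonempty 𝒮] [Nonempty 𝒜] (b : Policy 𝒮 𝒜) (μ : 𝒮 → ℝ) (y : 𝒮 × 𝒜) :
    minOcc b μ ≤ occ b μ y :=
  Finset.inf'_le (fun y : 𝒮 × 𝒜 => μ y.1 * b.prob y.1 y.2) (Finset.mem_univ y)

theorem minOcc_pos [Nonempty 𝒮] [Nonempty 𝒜] [DecidableEq 𝒮] {M : FiniteMDP 𝒮 𝒜}
    {b : Policy 𝒮 𝒜} {μ : 𝒮 → ℝ} (hpos : ∀ s a, 0 < b.prob s a)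
    (hirr : (stateChain M b).IsIrreducible) (h : IsStationary M b μ) : 0 < minOcc b μ :=
  (Finset.lt_inf'_iff _).2 fun y _ => mul_pos (h.pos hirr y.1) (hpos _ _)

theorem numPairs_mul_minOcc_le [Nonempty 𝒮] [Nonempty 𝒜] {M : FiniteMDP 𝒮 𝒜} {b : Policy 𝒮 𝒜}
    {μ : 𝒮 → ℝ} (h : IsStationary M b μ) : numPairs 𝒮 𝒜 * minOcc b μ ≤ 1 := by
  rw [← sum_occ h]
  have := Finset.card_nsmul_le_sum Finset.univ (occ b μ) (minOcc b μ)
    fun y _ => minOcc_le_occ b μ y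
  simpa [numPairs] using this

end PairChain

/-! ### Chains killed at a target state, and the Poisson equation -/

section Taboo

variable {σ : Type*} [Fintype σ] [DecidableEq σ]

/-- `P_y(Y_0 ≠ y₀, …, Y_n ≠ y₀, Y_n = z)` for the chain with transition matrix `p`. -/
def tabooMass (p : σ → σ → ℝ) (y₀ : σ) : ℕ → σ → σ → ℝ
  | 0, y, z => if y ≠ y₀ ∧ y = z then 1 else 0
  | n + 1, y, z => if y = y₀ then 0 else ∑ y', p y y' * tabooMass p y₀ n y' z

/-- `P_y(Y_0 ≠ y₀, …, Y_n ≠ y₀)` for the chain with transition matrix `p`. -/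
def survival (p : σ → σ → ℝ) (y₀ : σ) (n : ℕ) (y : σ) : ℝ := ∑ z, tabooMass p y₀ n y z

variable {p : σ → σ → ℝ} {y₀ : σ}

theorem tabooMass_nonneg (hp : ∀ y z, 0 ≤ p y z) (n : ℕ) (y z : σ) :
    0 ≤ tabooMass p y₀ n y z := by
  induction n generalizing y with
  | zero => unfold tabooMass; split_ifs <;> norm_num
  | succ n ih =>
    unfold tabooMass
    split_ifs
    · exact le_rfl
    · exact Finset.sum_nonneg fun y' _ => mul_nonneg (hp _ _) (ih y')

theorem survival_nonneg (hp : ∀ y z, 0 ≤ p y z) (n : ℕ) (y : σ) : 0 ≤ survival p y₀ n y :=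
  Finset.sum_nonneg fun z _ => tabooMass_nonneg hp n y z

theorem tabooMass_le_survival (hp : ∀ y z, 0 ≤ p y z) (n : ℕ) (y z : σ) :
    tabooMass p y₀ n y z ≤ survival p y₀ n y :=
  Finset.single_le_sum (f := fun z => tabooMass p y₀ n y z)
    (fun z _ => tabooMass_nonneg hp n y z) (Finset.mem_univ z)

theorem survival_zero (y : σ) : survival p y₀ 0 y = if y = y₀ then 0 else 1 := by
  by_cases h : y = y₀ <;> simp [survival, tabooMass, h]

theorem survival_succ (n : ℕ) (y : σ) :
    survival p y₀ (n + 1) y = if y = y₀ then 0 else ∑ y', p y y' * survival p y₀ n y' := by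
  by_cases h : y = y₀
  · simp [survival, tabooMass, h]
  · simp only [survival, tabooMass, h, if_false, Finset.mul_sum]
    exact Finset.sum_comm

theorem survival_self (n : ℕ) : survival p y₀ n y₀ = 0 := by
  cases n with
  | zero => simp [survival_zero]
  | succ n => simp [survival_succ]

theorem survival_le_one (hp : ∀ y z, 0 ≤ p y z) (hp1 : ∀ y, ∑ z, p y z = 1) (n : ℕ) (y : σ) :
    survival p y₀ n y ≤ 1 := by
  induction n generalizing y with
  | zero => rw [survival_zero]; split_ifs <;> norm_num
  | succ n ih =>
    rw [survival_succ]
    split_ifs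
    · norm_num
    · rw [← hp1 y]
      exact Finset.sum_le_sum fun z _ => mul_le_of_le_one_right (hp _ _) (ih z)

theorem survival_succ_le (hp : ∀ y z, 0 ≤ p y z) (hp1 : ∀ y, ∑ z, p y z = 1) (n : ℕ) (y : σ) :
    survival p y₀ (n + 1) y ≤ survival p y₀ n y := by
  induction n generalizing y with
  | zero =>
    rw [survival_zero, survival_succ]
    split_ifs
    · exact le_rfl
    · rw [← hp1 y]
      exact Finset.sum_le_sum fun z _ =>
        mul_le_of_le_one_right (hp _ _) (survival_le_one hp hp1 _ z)
  | succ n ih =>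
    rw [survival_succ, survival_succ n]
    split_ifs
    · exact le_rfl
    · exact Finset.sum_le_sum fun z _ => mul_le_mul_of_nonneg_left (ih z) (hp _ _)

theorem survival_antitone (hp : ∀ y z, 0 ≤ p y z) (hp1 : ∀ y, ∑ z, p y z = 1) (y : σ) :
    Antitone fun n => survival p y₀ n y :=
  antitone_nat_of_succ_le fun n => survival_succ_le hp hp1 n y

/-- Submultiplicativity: wherever the chain stands after `n` steps, it survives another `N` with
probability at most `ρ`. -/
theorem survival_add_le (hp : ∀ y z, 0 ≤ p y z) {N : ℕ} {ρ : ℝ}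
    (hρ : ∀ y, survival p y₀ N y ≤ ρ) (n : ℕ) (y : σ) :
    survival p y₀ (n + N) y ≤ ρ * survival p y₀ n y := by
  induction n generalizing y with
  | zero =>
    rw [zero_add, survival_zero]
    split_ifs with h
    · rw [h, survival_self, mul_zero]
    · simpa using hρ y
  | succ n ih =>
    rw [show n + 1 + N = (n + N) + 1 by ring, survival_succ, survival_succ]
    split_ifs
    · simp
    · rw [Finset.mul_sum]
      refine Finset.sum_le_sum fun z _ => ?_
      calc p y z * survival p y₀ (n + N) z ≤ p y z * (ρ * survival p y₀ n z) :=
            mul_le_mul_of_nonneg_left (ih z) (hp _ _)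
        _ = _ := by ring

/-- If from every state the target is reached with positive probability, then the tails of the
hitting times are summable. -/
theorem summable_survival [Nonempty σ] (hp : ∀ y z, 0 ≤ p y z) (hp1 : ∀ y, ∑ z, p y z = 1)
    (hreach : ∀ y, ∃ n, survival p y₀ n y < 1) (y : σ) :
    Summable fun n => survival p y₀ n y := by
  choose f hf using hreach
  set N := Finset.univ.sup' Finset.univ_nonempty f with hN
  set ρ := Finset.univ.sup' Finset.univ_nonempty fun y => survival p y₀ N y with hρdef
  have hρ : ∀ y, survival p y₀ N y ≤ ρ := fun y =>
    Finset.le_sup' (fun y => survival p y₀ N y) (Finset.mem_univ y)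
  have hρ1 : ρ < 1 := (Finset.sup'_lt_iff _).2 fun y _ =>
    (survival_antitone hp hp1 y (Finset.le_sup' f (Finset.mem_univ y))).trans_lt (hf y)
  have h0 : ∀ n, 0 ≤ survival p y₀ n y := fun n => survival_nonneg hp n y
  have hρ0 : 0 ≤ ρ := (survival_nonneg hp N y).trans (hρ y)
  -- The first `N` terms add up to at most `N`, and a shift by `N` costs a factor `ρ`, so each
  -- partial sum `s` satisfies `s ≤ N + ρ s`.
  refine summable_of_sum_range_le (c := N / (1 - ρ)) h0 fun k => ?_
  rw [le_div_iff₀ (by linarith)]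
  have hmono : ∑ n ∈ Finset.range k, survival p y₀ n y ≤
      ∑ n ∈ Finset.range (N + k), survival p y₀ n y :=
    Finset.sum_le_sum_of_subset_of_nonneg (Finset.range_mono (by omega)) fun n _ _ => h0 n
  have h1 : ∑ n ∈ Finset.range (N + k), survival p y₀ n y =
      ∑ n ∈ Finset.range N, survival p y₀ n y + ∑ n ∈ Finset.range k, survival p y₀ (N + n) y :=
    Finset.sum_range_add _ _ _
  have h2 : ∑ n ∈ Finset.range N, survival p y₀ n y ≤ N := by
    simpa using Finset.sum_le_card_nsmul (Finset.range N) (fun n => survival p y₀ n y) 1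
      fun n _ => survival_le_one hp hp1 n y
  have h3 : ∑ n ∈ Finset.range k, survival p y₀ (N + n) y ≤
      ρ * ∑ n ∈ Finset.range k, survival p y₀ n y := by
    rw [Finset.mul_sum]
    refine Finset.sum_le_sum fun n _ => ?_
    rw [add_comm N n]
    exact survival_add_le hp hρ n y
  linarith

/-- A bounded solution of the Poisson equation for the indicator of a state. -/
theorem exists_poisson (hp : ∀ y z, 0 ≤ p y z)
    (hs : ∀ y, Summable fun n => survival p y₀ n y) {Λ : σ → ℝ} (hΛ : ∀ y, 0 < Λ y)
    (hΛ1 : ∑ y, Λ y = 1) (hinv : ∀ z, ∑ y, Λ y * p y z = Λ z) {τ : ℝ}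
    (hτ : ∀ y, ∑' n, survival p y₀ n y ≤ τ) :
    ∃ v : σ → σ → ℝ, (∀ z y, |v z y| ≤ τ) ∧
      ∀ z y, v z y - ∑ y', p y y' * v z y' = (if y = z then 1 else 0) - Λ z := by
  have hsG : ∀ y z, Summable fun n => tabooMass p y₀ n y z := fun y z =>
    Summable.of_nonneg_of_le (fun n => tabooMass_nonneg hp n y z)
      (fun n => tabooMass_le_survival hp n y z) (hs y)
  set G : σ → σ → ℝ := fun y z => ∑' n, tabooMass p y₀ n y z with hG
  set T : σ → ℝ := fun y => ∑' n, survival p y₀ n y with hT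
  have hG0 : ∀ y z, 0 ≤ G y z := fun y z => tsum_nonneg fun n => tabooMass_nonneg hp n y z
  have hGT : ∀ y z, G y z ≤ T y := fun y z =>
    (hsG y z).tsum_le_tsum (fun n => tabooMass_le_survival hp n y z) (hs y)
  have hΛle : ∀ z, Λ z ≤ 1 := fun z => by
    rw [← hΛ1]
    exact Finset.single_le_sum (fun y _ => (hΛ y).le) (Finset.mem_univ z)
  have hGstep : ∀ y z, y ≠ y₀ → G y z = (if y = z then 1 else 0) + ∑ y', p y y' * G y' z := by
    intro y z hy
    simp only [hG]
    rw [(hsG y z).tsum_eq_zero_add]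
    simp only [tabooMass, hy, if_false, ne_eq, not_false_eq_true, true_and]
    rw [Summable.tsum_finsetSum fun y' _ => (hsG y' z).mul_left _]
    simp_rw [tsum_mul_left]
  have hTstep : ∀ y, y ≠ y₀ → T y = 1 + ∑ y', p y y' * T y' := by
    intro y hy
    simp only [hT]
    rw [(hs y).tsum_eq_zero_add]
    simp only [survival_zero, survival_succ, hy, if_false]
    rw [Summable.tsum_finsetSum fun y' _ => (hs y').mul_left _]
    simp_rw [tsum_mul_left]
  -- Expected visits to `z` before hitting `y₀`, minus the stationary share of the hitting time.
  -- Both terms lie in `[0, T y]`, so `|v|` is bounded by `τ` rather than `2τ`.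
  set v : σ → σ → ℝ := fun z y => G y z - Λ z * T y with hv
  have hne : ∀ z y, y ≠ y₀ →
      v z y - ∑ y', p y y' * v z y' = (if y = z then 1 else 0) - Λ z := by
    intro z y hy
    have e : ∑ y', p y y' * v z y' =
        ∑ y', p y y' * G y' z - Λ z * ∑ y', p y y' * T y' := by
      rw [Finset.mul_sum, ← Finset.sum_sub_distrib]
      exact Finset.sum_congr rfl fun y' _ => by simp only [hv]; ring
    rw [e]
    simp only [hv]
    rw [hGstep y z hy, hTstep y hy]
    ring
  refine ⟨v, fun z y => ?_, fun z y => ?_⟩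
  · have h1 := hG0 y z
    have h2 := hGT y z
    have h3 := hτ y
    have h4 : Λ z * T y ≤ T y := mul_le_of_le_one_left (h1.trans h2) (hΛle z)
    have h5 : 0 ≤ Λ z * T y := mul_nonneg (hΛ z).le (h1.trans h2)
    simp only [hv]
    rw [abs_le]
    constructor <;> linarith [show T y ≤ τ from h3]
  · by_cases hy : y = y₀
    -- First-step analysis is not available at `y₀`, where the chain is killed. But both sides of
    -- the equation have `Λ`-mean zero and agree off `y₀`, so they agree at `y₀` because `Λ y₀ > 0`.
    · have hz1 : ∑ y, Λ y * (v z y - ∑ y', p y y' * v z y') = 0 := by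
        simp_rw [mul_sub, Finset.sum_sub_distrib, Finset.mul_sum]
        rw [Finset.sum_comm (f := fun y y' => Λ y * (p y y' * v z y'))]
        simp_rw [← mul_assoc, ← Finset.sum_mul, hinv, sub_self]
      have hz2 : ∑ y, Λ y * ((if y = z then 1 else 0) - Λ z) = 0 := by
        simp_rw [mul_sub, Finset.sum_sub_distrib, ← Finset.sum_mul, hΛ1]
        simp
      have hz3 : ∑ y, Λ y * ((v z y - ∑ y', p y y' * v z y') -
          ((if y = z then 1 else 0) - Λ z)) = 0 := by
        simp_rw [mul_sub (Λ _) (_ - _) (_ - _), Finset.sum_sub_distrib, hz1, hz2, sub_self]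
      rw [Finset.sum_eq_single y₀ (fun y _ hy => by rw [hne z y hy, sub_self, mul_zero])
        (fun h => absurd (Finset.mem_univ _) h)] at hz3
      rw [hy]
      exact sub_eq_zero.1 ((mul_eq_zero.1 hz3).resolve_left (hΛ y₀).ne')
    · exact hne z y hy

end Taboo

/-! ### Hitting times of the state-action chain -/

section Hitting

variable {𝒮 𝒜 : Type*} [Fintype 𝒮] [Fintype 𝒜] [DecidableEq 𝒮] [DecidableEq 𝒜]

theorem avoidProb_zero (M : FiniteMDP 𝒮 𝒜) (b : Policy 𝒮 𝒜) (y₀ y : 𝒮 × 𝒜) :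
    avoidProb M b y₀ y 0 = if y = y₀ then 0 else 1 := by
  unfold avoidProb
  rw [← (Equiv.funUnique (Fin 1) (𝒮 × 𝒜)).symm.sum_comp]
  simp only [Finset.univ_eq_empty, Finset.prod_empty]
  rw [Finset.sum_eq_single y]
  · by_cases h : y = y₀ <;> simp [h]
  · intro z _ hz
    simp [hz]
  · simp

theorem avoidProb_succ (M : FiniteMDP 𝒮 𝒜) (b : Policy 𝒮 𝒜) (y₀ y : 𝒮 × 𝒜) (n : ℕ) :
    avoidProb M b y₀ y (n + 1) =
      if y = y₀ then 0 else ∑ z, pairChain M b y z * avoidProb M b y₀ z n := by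
  have key : avoidProb M b y₀ y (n + 1) = ∑ w : Fin (n + 1) → 𝒮 × 𝒜,
      if y ≠ y₀ ∧ ∀ i, w i ≠ y₀ then
        pairChain M b y (w 0) * ∏ i : Fin n, pairChain M b (w i.castSucc) (w i.succ) else 0 := by
    unfold avoidProb
    rw [← (Fin.consEquiv fun _ : Fin (n + 2) => 𝒮 × 𝒜).sum_comp, Fintype.sum_prod_type,
      Finset.sum_eq_single y]
    · refine Finset.sum_congr rfl fun w _ => ?_
      simp [Fin.consEquiv, Fin.forall_fin_succ, Fin.prod_univ_succ]
    · intro z _ hz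
      simp [Fin.consEquiv, hz]
    · simp
  rw [key]
  by_cases h : y = y₀
  · simp [h]
  · simp only [h, ne_eq, not_false_eq_true, true_and, if_false, avoidProb, Finset.mul_sum]
    rw [Finset.sum_comm]
    refine Finset.sum_congr rfl fun w _ => ?_
    rw [Finset.sum_eq_single (w 0)]
    · simp
    · intro z _ hz
      simp [hz.symm]
    · simp

theorem avoidProb_eq_survival (M : FiniteMDP 𝒮 𝒜) (b : Policy 𝒮 𝒜) (y₀ y : 𝒮 × 𝒜) (n : ℕ) :
    avoidProb M b y₀ y n = survival (pairChain M b) y₀ n y := by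
  induction n generalizing y with
  | zero => rw [avoidProb_zero, survival_zero]
  | succ n ih => simp_rw [avoidProb_succ, survival_succ, ih]

variable {M : FiniteMDP 𝒮 𝒜} {b : Policy 𝒮 𝒜} {y₀ : 𝒮 × 𝒜}

/-- A path of the state chain to the state of `y₀` lifts to a path of pairs ending at `y₀`, because
every action has positive probability. -/
theorem exists_survival_lt_one (hpos : ∀ s a, 0 < b.prob s a)
    (hirr : (stateChain M b).IsIrreducible) (y : 𝒮 × 𝒜) :
    ∃ n, survival (pairChain M b) y₀ n y < 1 := by
  have step : ∀ y z, 0 < pairChain M b y z →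
      (∃ n, survival (pairChain M b) y₀ n z < 1) →
      ∃ n, survival (pairChain M b) y₀ n y < 1 := by
    rintro y z hyz ⟨n, hn⟩
    refine ⟨n + 1, ?_⟩
    rw [survival_succ]
    split_ifs
    · exact one_pos
    · rw [← pairChain_sum M b y]
      refine Finset.sum_lt_sum (fun w _ => mul_le_of_le_one_right (pairChain_nonneg M b _ _)
        (survival_le_one (pairChain_nonneg M b) (pairChain_sum M b) n w)) ⟨z, Finset.mem_univ z, ?_⟩
      exact mul_lt_of_lt_one_right hyz hn
  -- The action at `s` cannot be prescribed here: it must be one under which the next state of the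
  -- path is reachable. The prescribed first pair `y` is handled by one extra step at the end.
  have hst : ∀ (k : ℕ) (s : 𝒮), 0 < (stateChain M b ^ k) s y₀.1 →
      ∃ a, ∃ n, survival (pairChain M b) y₀ n (s, a) < 1 := by
    intro k
    induction k with
    | zero =>
      intro s hs
      have : s = y₀.1 := by
        by_contra h
        simp [h] at hs
      refine ⟨y₀.2, 0, ?_⟩
      rw [this, Prod.mk.eta, survival_self]
      exact one_pos
    | succ k ih =>
      intro s hs
      rw [pow_succ', Matrix.mul_apply] at hs
      obtain ⟨s', -, hs'⟩ := Finset.exists_lt_of_sum_lt (s := Finset.univ)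
        (f := fun _ : 𝒮 => (0 : ℝ)) (by simpa using hs)
      have h1 := hirr.nonneg s s'
      have h2 := Matrix.pow_apply_nonneg hirr.nonneg k s' y₀.1
      have h3 : 0 < stateChain M b s s' :=
        lt_of_le_of_ne h1 fun h => by rw [← h, zero_mul] at hs'; exact lt_irrefl _ hs'
      have h4 : 0 < (stateChain M b ^ k) s' y₀.1 :=
        lt_of_le_of_ne h2 fun h => by rw [← h, mul_zero] at hs'; exact lt_irrefl _ hs'
      obtain ⟨a', ha'⟩ := ih s' h4
      unfold stateChain at h3
      obtain ⟨a, -, ha⟩ := Finset.exists_lt_of_sum_lt (s := Finset.univ)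
        (f := fun _ : 𝒜 => (0 : ℝ)) (by simpa using h3)
      refine ⟨a, step _ (s', a') ?_ ha'⟩
      exact mul_pos (pos_of_mul_pos_right ha (b.prob_nonneg _ _)) (hpos _ _)
  obtain ⟨s', -, hs'⟩ := Finset.exists_lt_of_sum_lt (s := Finset.univ)
    (f := fun _ : 𝒮 => (0 : ℝ)) (g := M.trans y.1 y.2) (by simp [M.trans_sum])
  obtain ⟨k, -, hk⟩ := (Matrix.isIrreducible_iff_exists_pow_pos hirr.nonneg).1 hirr s' y₀.1
  obtain ⟨a', ha'⟩ := hst k s' hk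
  exact step _ (s', a') (mul_pos hs' (hpos _ _)) ha'

theorem summable_survival_pairChain [Nonempty 𝒮] [Nonempty 𝒜] (hpos : ∀ s a, 0 < b.prob s a)
    (hirr : (stateChain M b).IsIrreducible) (y : 𝒮 × 𝒜) :
    Summable fun n => survival (pairChain M b) y₀ n y :=
  summable_survival (pairChain_nonneg M b) (pairChain_sum M b)
    (exists_survival_lt_one hpos hirr) y

theorem expHitting_eq [Nonempty 𝒮] [Nonempty 𝒜] (hpos : ∀ s a, 0 < b.prob s a)
    (hirr : (stateChain M b).IsIrreducible) (y : 𝒮 × 𝒜) :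
    expHitting M b y₀ y = ENNReal.ofReal (∑' n, survival (pairChain M b) y₀ n y) := by
  unfold expHitting
  simp_rw [avoidProb_eq_survival]
  exact (ENNReal.ofReal_tsum_of_nonneg (fun n => survival_nonneg (pairChain_nonneg M b) n y)
    (summable_survival_pairChain hpos hirr y)).symm

theorem tsum_survival_le_maxHitting [Nonempty 𝒮] [Nonempty 𝒜] (hpos : ∀ s a, 0 < b.prob s a)
    (hirr : (stateChain M b).IsIrreducible) (y : 𝒮 × 𝒜) :
    ∑' n, survival (pairChain M b) y₀ n y ≤ maxHitting M b y₀ := by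
  have h := Finset.le_sup' (fun y => (expHitting M b y₀ y).toReal) (Finset.mem_univ y)
  rw [expHitting_eq hpos hirr, ENNReal.toReal_ofReal
    (tsum_nonneg fun n => survival_nonneg (pairChain_nonneg M b) n y)] at h
  exact h

/-- From any pair other than `y₀`, already the term `n = 0` of the tail sum equals one. -/
theorem one_le_maxHitting [Nonempty 𝒮] [Nonempty 𝒜] (hpos : ∀ s a, 0 < b.prob s a)
    (hirr : (stateChain M b).IsIrreducible) (hcard : 2 ≤ Fintype.card 𝒮 * Fintype.card 𝒜) :
    1 ≤ maxHitting M b y₀ := by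
  have : Nontrivial (𝒮 × 𝒜) := by
    rw [← Fintype.one_lt_card_iff_nontrivial, Fintype.card_prod]
    omega
  obtain ⟨y, hy⟩ := exists_ne y₀
  refine le_trans ?_ (tsum_survival_le_maxHitting hpos hirr y)
  have h := (summable_survival_pairChain (y₀ := y₀) hpos hirr y).le_tsum 0
    fun n _ => survival_nonneg (pairChain_nonneg M b) n y
  simpa [survival_zero, hy] using h

end Hitting

/-! ### One step of `Q`-learning and the drift inequality -/

section OneStep

variable {𝒮 𝒜 : Type*} [Fintype 𝒮] [Fintype 𝒜] [Nonempty 𝒜]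

/-- The Bellman residual `B(Q) - Q`. -/
def resid (M : FiniteMDP 𝒮 𝒜) (Q : 𝒮 × 𝒜 → ℝ) (w : 𝒮 × 𝒜) : ℝ := bellman M Q w - Q w

theorem abs_bellman_sub_le (M : FiniteMDP 𝒮 𝒜) (Q R : 𝒮 × 𝒜 → ℝ) (w : 𝒮 × 𝒜) :
    |bellman M Q w - bellman M R w| ≤ M.disc * ‖Q - R‖ := by
  have h := (bellman_contracting M).2.dist_le_mul Q R
  rw [dist_eq_norm, dist_eq_norm] at h
  exact (norm_le_pi_norm (bellman M Q - bellman M R) w).trans h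

theorem abs_resid_sub_le (M : FiniteMDP 𝒮 𝒜) (Q R : 𝒮 × 𝒜 → ℝ) (w : 𝒮 × 𝒜) :
    |resid M Q w - resid M R w| ≤ 2 * ‖Q - R‖ := by
  have h1 := abs_bellman_sub_le M Q R w
  have h2 : |Q w - R w| ≤ ‖Q - R‖ := norm_le_pi_norm (Q - R) w
  have h3 : M.disc * ‖Q - R‖ ≤ ‖Q - R‖ := mul_le_of_le_one_left (norm_nonneg _) M.disc_lt_one.le
  have h4 := abs_sub (bellman M Q w - bellman M R w) (Q w - R w)
  rw [show resid M Q w - resid M R w =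
    (bellman M Q w - bellman M R w) - (Q w - R w) by unfold resid; ring]
  linarith

theorem resid_Qstar (M : FiniteMDP 𝒮 𝒜) (w : 𝒮 × 𝒜) : resid M (Qstar M) w = 0 := by
  rw [resid, bellman_Qstar, sub_self]

theorem abs_resid_le (M : FiniteMDP 𝒮 𝒜) (Q : 𝒮 × 𝒜 → ℝ) (w : 𝒮 × 𝒜) :
    |resid M Q w| ≤ 2 * ‖Q - Qstar M‖ := by
  simpa [resid_Qstar] using abs_resid_sub_le M Q (Qstar M) w

theorem abs_maxQ_le (Q : 𝒮 × 𝒜 → ℝ) (s : 𝒮) : |maxQ Q s| ≤ ‖Q‖ := by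
  have h : maxQ (0 : 𝒮 × 𝒜 → ℝ) s = 0 := by simp [maxQ]
  simpa [h] using abs_maxQ_sub_le Q 0 s

/-- The temporal difference at `w` when the next state is `s'`. -/
def tdError (M : FiniteMDP 𝒮 𝒜) (Q : 𝒮 × 𝒜 → ℝ) (w : 𝒮 × 𝒜) (s' : 𝒮) : ℝ :=
  M.reward w.1 w.2 + M.disc * maxQ Q s' - Q w

/-- Subtracting the Bellman equation for `Q*` at `w` eliminates the reward. -/
theorem abs_tdError_le (M : FiniteMDP 𝒮 𝒜) (Q : 𝒮 × 𝒜 → ℝ) (w : 𝒮 × 𝒜) (s' : 𝒮) :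
    |tdError M Q w s'| ≤ 2 * (‖Q - Qstar M‖ + ‖Qstar M‖) := by
  have hfix := congrFun (bellman_Qstar M) w
  have hsum : |∑ s', M.trans w.1 w.2 s' * maxQ (Qstar M) s'| ≤ ‖Qstar M‖ := by
    calc |∑ s', M.trans w.1 w.2 s' * maxQ (Qstar M) s'|
        ≤ ∑ s', |M.trans w.1 w.2 s' * maxQ (Qstar M) s'| := Finset.abs_sum_le_sum_abs _ _
      _ ≤ ∑ s', M.trans w.1 w.2 s' * ‖Qstar M‖ := by
          refine Finset.sum_le_sum fun s' _ => ?_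
          rw [abs_mul, abs_of_nonneg (M.trans_nonneg _ _ _)]
          exact mul_le_mul_of_nonneg_left (abs_maxQ_le _ _) (M.trans_nonneg _ _ _)
      _ = ‖Qstar M‖ := by rw [← Finset.sum_mul, M.trans_sum, one_mul]
  have h1 : |maxQ Q s' - maxQ (Qstar M) s'| ≤ ‖Q - Qstar M‖ := abs_maxQ_sub_le _ _ _
  have h2 := abs_maxQ_le (Qstar M) s'
  have h3 : |Q w - Qstar M w| ≤ ‖Q - Qstar M‖ := norm_le_pi_norm (Q - Qstar M) w
  have e : tdError M Q w s' = M.disc * ((maxQ Q s' - maxQ (Qstar M) s') + maxQ (Qstar M) s' -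
      ∑ s', M.trans w.1 w.2 s' * maxQ (Qstar M) s') - (Q w - Qstar M w) := by
    unfold bellman at hfix
    unfold tdError
    linear_combination hfix
  have h4 : |(maxQ Q s' - maxQ (Qstar M) s') + maxQ (Qstar M) s' -
      ∑ s', M.trans w.1 w.2 s' * maxQ (Qstar M) s'| ≤ ‖Q - Qstar M‖ + 2 * ‖Qstar M‖ := by
    rw [abs_le] at *
    constructor <;> linarith [h1.1, h1.2, h2.1, h2.2, hsum.1, hsum.2]
  rw [e]
  refine (abs_sub _ _).trans ?_
  rw [abs_mul, abs_of_pos M.disc_pos]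
  have h5 := mul_le_of_le_one_left (abs_nonneg ((maxQ Q s' - maxQ (Qstar M) s') +
    maxQ (Qstar M) s' - ∑ s', M.trans w.1 w.2 s' * maxQ (Qstar M) s')) M.disc_lt_one.le
  linarith

theorem sum_pairChain_mul_tdError (M : FiniteMDP 𝒮 𝒜) (b : Policy 𝒮 𝒜) (Q : 𝒮 × 𝒜 → ℝ)
    (y : 𝒮 × 𝒜) : ∑ z, pairChain M b y z * tdError M Q y z.1 = resid M Q y := by
  rw [sum_pairChain_mul_fst M b y (tdError M Q y)]
  unfold tdError resid bellman
  simp_rw [mul_sub, mul_add, Finset.sum_sub_distrib, Finset.sum_add_distrib, ← Finset.sum_mul,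
    M.trans_sum, one_mul, Finset.mul_sum]
  congr 2
  exact Finset.sum_congr rfl fun s' _ => by ring

variable (m : ℕ) (M : FiniteMDP 𝒮 𝒜) (v : 𝒮 × 𝒜 → 𝒮 × 𝒜 → ℝ)

/-- The Lyapunov function corrected by a solution of the Poisson equation. -/
noncomputable def corrected (α : ℝ) (Q : 𝒮 × 𝒜 → ℝ) (y : 𝒮 × 𝒜) : ℝ :=
  lyap m (Q - Qstar M) + α * ∑ w, lyapGrad m (Q - Qstar M) w * (v w y * resid M Q w)

variable {m M v}

theorem norm_correction_le {τ : ℝ} (hv : ∀ w y, |v w y| ≤ τ) (hτ : 1 ≤ τ) (Q : 𝒮 × 𝒜 → ℝ)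
    (y : 𝒮 × 𝒜) : ‖fun w => v w y * resid M Q w‖ ≤ 2 * τ * ‖Q - Qstar M‖ := by
  refine (pi_norm_le_iff_of_nonneg (by positivity)).2 fun w => ?_
  rw [Real.norm_eq_abs, abs_mul]
  calc |v w y| * |resid M Q w| ≤ τ * (2 * ‖Q - Qstar M‖) :=
        mul_le_mul (hv w y) (abs_resid_le M Q w) (abs_nonneg _) (by linarith)
    _ = _ := by ring

theorem norm_correction_sub_le {τ : ℝ} (hv : ∀ w y, |v w y| ≤ τ) (hτ : 1 ≤ τ)
    (Q R : 𝒮 × 𝒜 → ℝ) (y : 𝒮 × 𝒜) :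
    ‖fun w => v w y * resid M Q w - v w y * resid M R w‖ ≤ 2 * τ * ‖Q - R‖ := by
  refine (pi_norm_le_iff_of_nonneg (by positivity)).2 fun w => ?_
  rw [Real.norm_eq_abs, ← mul_sub, abs_mul]
  calc |v w y| * |resid M Q w - resid M R w| ≤ τ * (2 * ‖Q - R‖) :=
        mul_le_mul (hv w y) (abs_resid_sub_le M Q R w) (abs_nonneg _) (by linarith)
    _ = _ := by ring

/-- The gradient and the residual both vanish at `Q*` and grow at most linearly, so the correction
is a relative error of order `α ρ`, without an additive term. -/
theorem abs_corrected_sub_le {τ ρ α : ℝ} (hm : 2 ≤ m) (hv : ∀ w y, |v w y| ≤ τ) (hτ : 1 ≤ τ)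
    (hρ : τ * ((4 * m - 3) * rootCard (𝒮 × 𝒜) m ^ 2) ≤ ρ) (hα : 0 ≤ α) (Q : 𝒮 × 𝒜 → ℝ)
    (y : 𝒮 × 𝒜) :
    |corrected m M v α Q y - lyap m (Q - Qstar M)| ≤ 4 * (α * ρ) * lyap m (Q - Qstar M) := by
  have hm1 : (2 : ℝ) ≤ m := by exact_mod_cast hm
  have h1 := abs_sum_lyapGrad_mul_le_norm hm (Q - Qstar M) fun w => v w y * resid M Q w
  have h2 := norm_correction_le (M := M) hv hτ Q y
  have h3 := norm_sq_le_lyap (m := m) (by omega) (Q - Qstar M)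
  have hκ : τ * rootCard (𝒮 × 𝒜) m ^ 2 ≤ ρ := by
    refine le_trans (mul_le_mul_of_nonneg_left ?_ (by linarith)) hρ
    exact le_mul_of_one_le_left (by positivity) (by linarith)
  rw [corrected, add_sub_cancel_left, abs_mul, abs_of_nonneg hα]
  calc _ ≤ α * (rootCard (𝒮 × 𝒜) m ^ 2 * ‖Q - Qstar M‖ * (2 * τ * ‖Q - Qstar M‖)) := by
        refine mul_le_mul_of_nonneg_left (h1.trans ?_) hα
        exact mul_le_mul_of_nonneg_left h2 (by positivity)
    _ = 2 * α * (τ * rootCard (𝒮 × 𝒜) m ^ 2) * ‖Q - Qstar M‖ ^ 2 := by ring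
    _ ≤ 2 * α * ρ * (2 * lyap m (Q - Qstar M)) := by
        have : 0 ≤ τ * rootCard (𝒮 × 𝒜) m ^ 2 := by positivity
        exact mul_le_mul (mul_le_mul_of_nonneg_left hκ (by linarith)) h3 (by positivity)
          (mul_nonneg (by linarith) (this.trans hκ))
    _ = _ := by ring

/-- The averaged update is a contraction towards `Q*`, seen by the Lyapunov function. -/
theorem sum_lyapGrad_mul_drift_le {Λ : 𝒮 × 𝒜 → ℝ} {l η : ℝ} (hm : 2 ≤ m) (hl : ∀ w, l ≤ Λ w)
    (hΛ0 : ∀ w, 0 ≤ Λ w) (hΛ1 : ∀ w, Λ w ≤ 1) (hη : η = (1 - M.disc) * l)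
    (hroot : rootCard (𝒮 × 𝒜) m * (1 - η) ≤ 1 - η / 2) (hη1 : η ≤ 1) (Q : 𝒮 × 𝒜 → ℝ) :
    ∑ w, lyapGrad m (Q - Qstar M) w * (Λ w * resid M Q w) ≤ -(η * lyap m (Q - Qstar M)) := by
  set x := Q - Qstar M with hx
  have hγ := M.disc_lt_one
  -- Each entry is a convex combination, with weights `1 - Λ w` and `Λ w`, of `x w` and a term of
  -- size at most `γ ‖x‖`.
  have hF : ‖fun w => x w + Λ w * resid M Q w‖ ≤ (1 - η) * ‖x‖ := by
    refine (pi_norm_le_iff_of_nonneg (mul_nonneg (by linarith) (norm_nonneg _))).2 fun w => ?_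
    have h1 : |bellman M Q w - Qstar M w| ≤ M.disc * ‖x‖ := by
      have := abs_bellman_sub_le M Q (Qstar M) w
      rwa [bellman_Qstar] at this
    have h2 : |x w| ≤ ‖x‖ := norm_le_pi_norm x w
    have e : x w + Λ w * resid M Q w =
        (1 - Λ w) * x w + Λ w * (bellman M Q w - Qstar M w) := by
      rw [resid, hx, Pi.sub_apply]; ring
    rw [Real.norm_eq_abs, e]
    refine (abs_add_le _ _).trans ?_
    rw [abs_mul, abs_mul, abs_of_nonneg (by linarith [hΛ1 w] : 0 ≤ 1 - Λ w),
      abs_of_nonneg (hΛ0 w)]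
    have h3 := mul_le_mul_of_nonneg_left h2 (by linarith [hΛ1 w] : 0 ≤ 1 - Λ w)
    have h4 := mul_le_mul_of_nonneg_left h1 (hΛ0 w)
    have h5 : (1 - M.disc) * l * ‖x‖ ≤ (1 - M.disc) * Λ w * ‖x‖ :=
      mul_le_mul_of_nonneg_right (mul_le_mul_of_nonneg_left (hl w) (by linarith)) (norm_nonneg _)
    rw [hη]
    linarith
  have h1 := (le_abs_self _).trans
    (abs_sum_lyapGrad_mul_le hm x fun w => x w + Λ w * resid M Q w)
  have h2 := sum_lyapGrad_mul_self hm x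
  have e : ∑ w, lyapGrad m x w * (x w + Λ w * resid M Q w) =
      ∑ w, lyapGrad m x w * x w + ∑ w, lyapGrad m x w * (Λ w * resid M Q w) := by
    rw [← Finset.sum_add_distrib]
    exact Finset.sum_congr rfl fun w _ => by ring
  rw [e, h2] at h1
  have hN := powNorm_nonneg m x
  have hr := rootCard_nonneg (ι := 𝒮 × 𝒜) m
  -- Passing between the sup norm and the `ℓ_{2m}` norm uses up half of the contraction; this is
  -- what `hroot` was arranged for.
  have h3 : powNorm m x * (rootCard (𝒮 × 𝒜) m * ‖fun w => x w + Λ w * resid M Q w‖) ≤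
      powNorm m x * ((1 - η / 2) * powNorm m x) := by
    refine mul_le_mul_of_nonneg_left ?_ hN
    calc _ ≤ rootCard (𝒮 × 𝒜) m * ((1 - η) * ‖x‖) := mul_le_mul_of_nonneg_left hF hr
      _ = rootCard (𝒮 × 𝒜) m * (1 - η) * ‖x‖ := by ring
      _ ≤ (1 - η / 2) * ‖x‖ := mul_le_mul_of_nonneg_right hroot (norm_nonneg _)
      _ ≤ _ := mul_le_mul_of_nonneg_left (norm_le_powNorm (by omega) x) (by linarith)
  unfold lyap
  linarith

/-- Collects the three second-order errors of one step, where `X` and `X'` are the errors before and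
after it and `D = ‖Q*‖`. The cross term, about `16 X D`, is split by a weighted square that keeps
the coefficient of `X²` small enough for the drift. -/
theorem quadratic_form_le {X D X' α : ℝ} (hX : 0 ≤ X) (hD : 0 ≤ D) (hX'0 : 0 ≤ X')
    (hα1 : α ≤ 1 / 1000) (hX' : X' ≤ X + α * (2 * (X + D))) :
    4 * (X + D) ^ 2 + 4 * (X + D) * (X + X') + X' ^ 2 / 2 ≤ 16 * X ^ 2 + 30 * D ^ 2 := by
  have h1 : X' ≤ 1.002 * X + 0.002 * D := by nlinarith
  have h2 : X' ^ 2 ≤ (1.002 * X + 0.002 * D) ^ 2 := pow_le_pow_left₀ hX'0 h1 2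
  have h3 : (X + D) * (X + X') ≤ (X + D) * (X + (1.002 * X + 0.002 * D)) :=
    mul_le_mul_of_nonneg_left (by linarith) (by linarith)
  nlinarith [sq_nonneg (X - 2.5 * D)]

variable [DecidableEq 𝒮] [DecidableEq 𝒜]

/-- One `Q`-learning step with step size `α` at the pair `y` when the next state is `s'`. -/
def update (M : FiniteMDP 𝒮 𝒜) (α : ℝ) (Q : 𝒮 × 𝒜 → ℝ) (y : 𝒮 × 𝒜) (s' : 𝒮) : 𝒮 × 𝒜 → ℝ :=
  fun w => Q w + α * (if y.1 = w.1 ∧ y.2 = w.2 then 1 else 0) * tdError M Q w s'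

theorem iterate_succ (M : FiniteMDP 𝒮 𝒜) (α : ℕ → ℝ) (Q₀ : 𝒮 × 𝒜 → ℝ) (s : ℕ → 𝒮) (a : ℕ → 𝒜)
    (k : ℕ) : iterate M α Q₀ s a (k + 1) =
      update M (α k) (iterate M α Q₀ s a k) (s k, a k) (s (k + 1)) := rfl

theorem update_eq (M : FiniteMDP 𝒮 𝒜) (α : ℝ) (Q : 𝒮 × 𝒜 → ℝ) (y : 𝒮 × 𝒜) (s' : 𝒮) :
    update M α Q y s' = Q + α • Pi.single y (tdError M Q y s') := by
  funext w
  simp only [update, Pi.add_apply, Pi.smul_apply, smul_eq_mul]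
  by_cases h : y = w
  · subst h
    simp
  · have h' : ¬ (y.1 = w.1 ∧ y.2 = w.2) := fun hh => h (Prod.ext hh.1 hh.2)
    simp [h', Pi.single_eq_of_ne (Ne.symm h)]

/-- The corrected Lyapunov function after one step, for a fixed next pair. -/
theorem corrected_update_le {τ ρ α α' : ℝ} (hm : 2 ≤ m) (hv : ∀ w y, |v w y| ≤ τ) (hτ : 1 ≤ τ)
    (hρ : τ * ((4 * m - 3) * rootCard (𝒮 × 𝒜) m ^ 2) ≤ ρ) (hα : 0 ≤ α) (hα1 : α ≤ 1 / 1000)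
    (hle : α' ≤ α) (hsub : α - α' ≤ α ^ 2 / 4) (Q : 𝒮 × 𝒜 → ℝ) (y z : 𝒮 × 𝒜) :
    corrected m M v α' (update M α Q y z.1) z ≤
      lyap m (Q - Qstar M) + α * (lyapGrad m (Q - Qstar M) y * tdError M Q y z.1) +
        α * ∑ w, lyapGrad m (Q - Qstar M) w * (v w z * resid M Q w) +
        α ^ 2 * ρ * (16 * ‖Q - Qstar M‖ ^ 2 + 30 * ‖Qstar M‖ ^ 2) := by
  have hm1 : (2 : ℝ) ≤ m := by exact_mod_cast hm
  set Q' := update M α Q y z.1 with hQ'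
  set x := Q - Qstar M with hx
  set u : 𝒮 × 𝒜 → ℝ := α • Pi.single y (tdError M Q y z.1) with hu
  set X := ‖x‖ with hX
  set D := ‖Qstar M‖ with hD
  set κ := rootCard (𝒮 × 𝒜) m ^ 2 with hκ
  set L := (4 * m - 3) * κ with hL
  have hQ'x : Q' - Qstar M = x + u := by rw [hQ', update_eq, hx]; abel
  have hQ'Q : Q' - Q = u := by rw [hQ', update_eq]; abel
  have hX0 : 0 ≤ X := norm_nonneg _
  have hD0 : 0 ≤ D := norm_nonneg _
  have hκ0 : 0 ≤ κ := by positivity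
  have hκL : κ ≤ L := le_mul_of_one_le_left hκ0 (by linarith)
  have hL0 : 0 ≤ L := hκ0.trans hκL
  have hLρ : L ≤ ρ := le_trans (le_mul_of_one_le_left hL0 hτ) hρ
  have hun : ‖u‖ ≤ α * (2 * (X + D)) := by
    rw [hu, norm_smul, Real.norm_of_nonneg hα]
    refine mul_le_mul_of_nonneg_left ?_ hα
    refine (pi_norm_le_iff_of_nonneg (by positivity)).2 fun w => ?_
    by_cases h : w = y
    · subst h
      rw [Pi.single_eq_same]
      exact abs_tdError_le M Q w z.1
    · rw [Pi.single_eq_of_ne h, norm_zero]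
      positivity
  set U := ‖u‖ with hU
  have hU0 : 0 ≤ U := norm_nonneg _
  set X' := ‖Q' - Qstar M‖ with hX'
  have hX'0 : 0 ≤ X' := norm_nonneg _
  have hX'le : X' ≤ X + U := by rw [hX', hQ'x]; exact norm_add_le _ _
  have t1 := lyap_add_le hm x u
  have hsingle : ∑ w, lyapGrad m x w * u w = α * (lyapGrad m x y * tdError M Q y z.1) := by
    rw [Finset.sum_eq_single y]
    · simp only [hu, Pi.smul_apply, Pi.single_eq_same, smul_eq_mul]; ring
    · intro w _ hw
      simp [hu, Pi.single_eq_of_ne hw]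
    · simp
  rw [hsingle] at t1
  set V : 𝒮 × 𝒜 → ℝ := fun w => v w z * resid M Q w with hV
  set V' : 𝒮 × 𝒜 → ℝ := fun w => v w z * resid M Q' w with hV'
  have nV : ‖V‖ ≤ 2 * τ * X := norm_correction_le hv hτ Q z
  have nV' : ‖V'‖ ≤ 2 * τ * X' := norm_correction_le hv hτ Q' z
  have nVV : ‖fun w => V' w - V w‖ ≤ 2 * τ * U := by
    have := norm_correction_sub_le (M := M) hv hτ Q' Q z
    rwa [hQ'Q] at this
  -- The correction changes for three reasons: the gradient moves (`s1`), the residual moves (`s2`),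
  -- and the step size drops from `α` to `α'` (`s3`). The last change is of order `α²` because of
  -- `hsub`.
  have s1 := (le_abs_self _).trans (abs_lyapGrad_sub_le hm x u V)
  have s2 := (le_abs_self _).trans
    (abs_sum_lyapGrad_mul_le_norm hm (x + u) fun w => V' w - V w)
  have s3 := (neg_le_abs _).trans (abs_sum_lyapGrad_mul_le_norm hm (x + u) V')
  rw [← hQ'x] at s1 s2 s3 t1
  have hsplit : ∑ w, lyapGrad m (Q' - Qstar M) w * (V' w - V w) =
      ∑ w, lyapGrad m (Q' - Qstar M) w * V' w - ∑ w, lyapGrad m (Q' - Qstar M) w * V w := by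
    rw [← Finset.sum_sub_distrib]
    exact Finset.sum_congr rfl fun w _ => by ring
  rw [hsplit] at s2
  have c1 : (4 * m - 3) * rootCard (𝒮 × 𝒜) m ^ 2 * U * ‖V‖ ≤ L * U * (2 * τ * X) :=
    mul_le_mul_of_nonneg_left nV (by positivity)
  have c2 : rootCard (𝒮 × 𝒜) m ^ 2 * X' * ‖fun w => V' w - V w‖ ≤ L * X' * (2 * τ * U) :=
    mul_le_mul (mul_le_mul_of_nonneg_right hκL hX'0) nVV (norm_nonneg _) (by positivity)
  have c3 : rootCard (𝒮 × 𝒜) m ^ 2 * X' * ‖V'‖ ≤ L * X' * (2 * τ * X') :=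
    mul_le_mul (mul_le_mul_of_nonneg_right hκL hX'0) nV' (norm_nonneg _) (by positivity)
  have hρ0 : 0 ≤ ρ := hL0.trans hLρ
  -- the three error terms
  have d1 : L * U ^ 2 ≤ α ^ 2 * ρ * (4 * (X + D) ^ 2) := by
    calc L * U ^ 2 ≤ ρ * (α * (2 * (X + D))) ^ 2 :=
          mul_le_mul hLρ (pow_le_pow_left₀ hU0 hun 2) (by positivity) hρ0
      _ = _ := by ring
  have d2 : α * (L * U * (2 * τ * X) + L * X' * (2 * τ * U)) ≤
      α ^ 2 * ρ * (4 * (X + D) * (X + X')) := by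
    calc α * (L * U * (2 * τ * X) + L * X' * (2 * τ * U))
        = α * (2 * (X + X')) * ((τ * L) * U) := by ring
      _ ≤ α * (2 * (X + X')) * (ρ * (α * (2 * (X + D)))) := by
          refine mul_le_mul_of_nonneg_left ?_ (by positivity)
          exact mul_le_mul hρ hun hU0 hρ0
      _ = _ := by ring
  have d3 : (α - α') * (L * X' * (2 * τ * X')) ≤ α ^ 2 * ρ * (X' ^ 2 / 2) := by
    calc (α - α') * (L * X' * (2 * τ * X')) = (α - α') * (τ * L) * (2 * X' ^ 2) := by ring
      _ ≤ α ^ 2 / 4 * ρ * (2 * X' ^ 2) := by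
          refine mul_le_mul_of_nonneg_right ?_ (by positivity)
          exact mul_le_mul hsub hρ (by positivity) (by positivity)
      _ = _ := by ring
  have q := mul_le_mul_of_nonneg_left
    (quadratic_form_le hX0 hD0 hX'0 hα1 (hX'le.trans (by linarith)))
    (by positivity : 0 ≤ α ^ 2 * ρ)
  have e1 : α * (∑ w, lyapGrad m (Q' - Qstar M) w * V' w - ∑ w, lyapGrad m x w * V w) ≤
      α * (L * U * (2 * τ * X) + L * X' * (2 * τ * U)) :=
    mul_le_mul_of_nonneg_left (by linarith) hα
  have e2 : (α - α') * -∑ w, lyapGrad m (Q' - Qstar M) w * V' w ≤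
      (α - α') * (L * X' * (2 * τ * X')) :=
    mul_le_mul_of_nonneg_left (by linarith) (by linarith)
  have t1' : lyap m (Q' - Qstar M) ≤
      lyap m x + α * (lyapGrad m x y * tdError M Q y z.1) + L * U ^ 2 := t1
  change lyap m (Q' - Qstar M) + α' * ∑ w, lyapGrad m (Q' - Qstar M) w * V' w ≤ _
  change _ ≤ _ + _ + α * ∑ w, lyapGrad m x w * V w + _
  linarith

/-- Drift inequality for the corrected Lyapunov function. -/
theorem sum_pairChain_mul_corrected_le {b : Policy 𝒮 𝒜} {Λ : 𝒮 × 𝒜 → ℝ} {l η τ ρ α α' : ℝ}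
    (hm : 2 ≤ m) (hl : ∀ w, l ≤ Λ w) (hΛ0 : ∀ w, 0 ≤ Λ w) (hΛ1 : ∀ w, Λ w ≤ 1)
    (hη : η = (1 - M.disc) * l) (hη0 : 0 ≤ η) (hη1 : η ≤ 1 / 2)
    (hroot : rootCard (𝒮 × 𝒜) m * (1 - η) ≤ 1 - η / 2)
    (hv : ∀ w y, |v w y| ≤ τ) (hτ : 1 ≤ τ)
    (hpoisson : ∀ w y, v w y - ∑ z, pairChain M b y z * v w z = (if y = w then 1 else 0) - Λ w)
    (hρ : τ * ((4 * m - 3) * rootCard (𝒮 × 𝒜) m ^ 2) ≤ ρ) (hα : 0 ≤ α) (hα1 : α ≤ 1 / 1000)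
    (hαρ : 125 * (α * ρ) ≤ η) (hle : α' ≤ α) (hsub : α - α' ≤ α ^ 2 / 4)
    (Q : 𝒮 × 𝒜 → ℝ) (y : 𝒮 × 𝒜) :
    ∑ z, pairChain M b y z * corrected m M v α' (update M α Q y z.1) z ≤
      (1 - α * η / 2) * corrected m M v α Q y + 30 * ρ * ‖Qstar M‖ ^ 2 * α ^ 2 := by
  have hm1 : (2 : ℝ) ≤ m := by exact_mod_cast hm
  set x := Q - Qstar M with hx
  have hdrift := sum_lyapGrad_mul_drift_le (M := M) hm hl hΛ0 hΛ1 hη hroot (by linarith) Q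
  rw [← hx] at hdrift
  -- The cancellation: the Poisson equation replaces the mean of `v w z` by `v w y - 1{y = w} + Λ
  -- w`. The indicator removes the conditional mean of the temporal-difference term, leaving the old
  -- correction and the stationary drift.
  have hsum : ∑ z, pairChain M b y z *
      (lyap m x + α * (lyapGrad m x y * tdError M Q y z.1) +
        α * ∑ w, lyapGrad m x w * (v w z * resid M Q w) +
        α ^ 2 * ρ * (16 * ‖x‖ ^ 2 + 30 * ‖Qstar M‖ ^ 2)) =
      corrected m M v α Q y + α * ∑ w, lyapGrad m x w * (Λ w * resid M Q w) +
        α ^ 2 * ρ * (16 * ‖x‖ ^ 2 + 30 * ‖Qstar M‖ ^ 2) := by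
    have e1 : ∑ z, pairChain M b y z * (α * (lyapGrad m x y * tdError M Q y z.1)) =
        α * (lyapGrad m x y * resid M Q y) := by
      rw [← sum_pairChain_mul_tdError M b, Finset.mul_sum, Finset.mul_sum]
      exact Finset.sum_congr rfl fun z _ => by ring
    have e2 : ∑ z, pairChain M b y z * (α * ∑ w, lyapGrad m x w * (v w z * resid M Q w)) =
        α * ∑ w, lyapGrad m x w *
          ((v w y - ((if y = w then 1 else 0) - Λ w)) * resid M Q w) := by
      have : ∀ w, v w y - ((if y = w then 1 else 0) - Λ w) =
          ∑ z, pairChain M b y z * v w z := fun w => by rw [← hpoisson w y]; ring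
      simp_rw [this, Finset.mul_sum, Finset.sum_mul, Finset.mul_sum]
      rw [Finset.sum_comm]
      exact Finset.sum_congr rfl fun w _ => Finset.sum_congr rfl fun z _ => by ring
    have e3 : ∑ w, lyapGrad m x w *
          ((v w y - ((if y = w then 1 else 0) - Λ w)) * resid M Q w) =
        ∑ w, lyapGrad m x w * (v w y * resid M Q w) - lyapGrad m x y * resid M Q y +
          ∑ w, lyapGrad m x w * (Λ w * resid M Q w) := by
      have : lyapGrad m x y * resid M Q y =
          ∑ w, lyapGrad m x w * ((if y = w then 1 else 0) * resid M Q w) := by simp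
      rw [this, ← Finset.sum_sub_distrib, ← Finset.sum_add_distrib]
      exact Finset.sum_congr rfl fun w _ => by ring
    simp_rw [mul_add, Finset.sum_add_distrib]
    rw [e1, e2, e3, ← Finset.sum_mul, ← Finset.sum_mul, ← Finset.sum_mul, pairChain_sum]
    rw [corrected]
    ring
  have hstep : ∑ z, pairChain M b y z * corrected m M v α' (update M α Q y z.1) z ≤ _ :=
    (Finset.sum_le_sum fun z _ => mul_le_mul_of_nonneg_left
      (corrected_update_le (M := M) hm hv hτ hρ hα hα1 hle hsub Q y z)
      (pairChain_nonneg M b y z)).trans hsum.le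
  have hc := (le_abs_self _).trans (abs_corrected_sub_le (M := M) (v := v) hm hv hτ hρ hα Q y)
  rw [← hx] at hc
  have hX := norm_sq_le_lyap (m := m) (by omega) x
  have hM := lyap_nonneg m x
  have hρ0 : 0 ≤ ρ := by
    refine le_trans (mul_nonneg (by linarith) (mul_nonneg (by linarith) (by positivity))) hρ
  -- Budget in units of `α η · lyap`: the drift supplies `1`, the quadratic error takes `0.256`, and
  -- the asserted decrease of the corrected function takes at most `0.508`.
  have f1 : α ^ 2 * ρ * (16 * ‖x‖ ^ 2) ≤ α * (η * lyap m x) * (32 / 125) := by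
    calc α ^ 2 * ρ * (16 * ‖x‖ ^ 2) ≤ α ^ 2 * ρ * (16 * (2 * lyap m x)) :=
          mul_le_mul_of_nonneg_left (by linarith) (by positivity)
      _ = 125 * (α * ρ) * (α * lyap m x * (32 / 125)) := by ring
      _ ≤ η * (α * lyap m x * (32 / 125)) :=
          mul_le_mul_of_nonneg_right hαρ (by positivity)
      _ = _ := by ring
  have f2 : 4 * (α * ρ) * lyap m x ≤ 4 / 250 * lyap m x :=
    mul_le_mul_of_nonneg_right (by linarith) hM
  have f3 : α * ∑ w, lyapGrad m x w * (Λ w * resid M Q w) ≤ α * -(η * lyap m x) :=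
    mul_le_mul_of_nonneg_left hdrift hα
  have f4 : α * η / 2 * corrected m M v α Q y ≤ α * η / 2 * (1.016 * lyap m x) :=
    mul_le_mul_of_nonneg_left (by linarith) (by positivity)
  have f5 : 0 ≤ α * (η * lyap m x) := by positivity
  rw [mul_add (α ^ 2 * ρ)] at hstep
  linarith

end OneStep

/-! ### Expectations of functions of a finite-valued map -/

section FiniteValued

variable {Ω β : Type*} [Fintype β] {X : Ω → β}

/-- Splitting over fibres means that only the fibres need be measurable; no σ-algebra on `β` is
involved. -/
theorem comp_eq_sum_indicator (F : β → ℝ) (ω : Ω) :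
    F (X ω) = ∑ x, Set.indicator {ω | X ω = x} (fun _ => F x) ω := by
  classical
  simp [Set.indicator_apply]

variable [MeasurableSpace Ω] {P : Measure Ω}

theorem integrable_comp_of_finite [IsFiniteMeasure P] (hX : ∀ x, MeasurableSet {ω | X ω = x})
    (F : β → ℝ) : Integrable (fun ω => F (X ω)) P := by
  simp_rw [comp_eq_sum_indicator F]
  exact integrable_finsetSum _ fun x _ => (integrable_const _).indicator (hX x)

theorem integral_comp_of_finite [IsFiniteMeasure P] (hX : ∀ x, MeasurableSet {ω | X ω = x})
    (F : β → ℝ) : ∫ ω, F (X ω) ∂P = ∑ x, P.real {ω | X ω = x} * F x := by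
  simp_rw [comp_eq_sum_indicator F]
  rw [integral_finsetSum _ fun x _ => (integrable_const _).indicator (hX x)]
  refine Finset.sum_congr rfl fun x _ => ?_
  rw [integral_indicator_const _ (hX x), smul_eq_mul]

end FiniteValued

/-! ### Markov property along a trajectory -/

section Trajectory

variable {𝒮 𝒜 Ω : Type*} {S : ℕ → Ω → 𝒮} {A : ℕ → Ω → 𝒜}

/-- The first `k + 1` state-action pairs. -/
def history (S : ℕ → Ω → 𝒮) (A : ℕ → Ω → 𝒜) (k : ℕ) (ω : Ω) : Fin (k + 1) → 𝒮 × 𝒜 :=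
  fun i => (S i ω, A i ω)

theorem history_eq_iff (k : ℕ) (w : Fin (k + 1) → 𝒮 × 𝒜) (ω : Ω) :
    history S A k ω = w ↔ ∀ i : Fin (k + 1), (S i ω, A i ω) = w i := funext_iff

variable [Fintype 𝒮] [Fintype 𝒜]

/-- The iterate after `k` steps is a function of the history. -/
theorem exists_iterate_eq [Nonempty 𝒜] [DecidableEq 𝒮] [DecidableEq 𝒜]
    (M : FiniteMDP 𝒮 𝒜) (α : ℕ → ℝ) (Q₀ : 𝒮 × 𝒜 → ℝ) (S : ℕ → Ω → 𝒮)
    (A : ℕ → Ω → 𝒜) (k : ℕ) :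
    ∃ f : (Fin (k + 1) → 𝒮 × 𝒜) → 𝒮 × 𝒜 → ℝ, ∀ ω,
      iterate M α Q₀ (fun i => S i ω) (fun i => A i ω) k = f (history S A k ω) := by
  induction k with
  | zero => exact ⟨fun _ => Q₀, fun _ => rfl⟩
  | succ k ih =>
    obtain ⟨f, hf⟩ := ih
    refine ⟨fun w => update M (α k) (f fun i => w i.castSucc) (w (Fin.last k).castSucc)
      (w (Fin.last (k + 1))).1, fun ω => ?_⟩
    rw [iterate_succ, hf]
    rfl

variable {M : FiniteMDP 𝒮 𝒜} {b : Policy 𝒮 𝒜} [MeasurableSpace Ω] {P : Measure Ω}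

theorem IsTrajectory.measurableSet_pair (h : IsTrajectory M b P S A) (k : ℕ) (y : 𝒮 × 𝒜) :
    MeasurableSet {ω | (S k ω, A k ω) = y} := by
  have : {ω | (S k ω, A k ω) = y} = {ω | S k ω = y.1} ∩ {ω | A k ω = y.2} := by
    ext ω
    simp [Prod.ext_iff]
  rw [this]
  exact (h.measurableSet_state k y.1).inter (h.measurableSet_action k y.2)

theorem IsTrajectory.measurableSet_history (h : IsTrajectory M b P S A) (k : ℕ)
    (w : Fin (k + 1) → 𝒮 × 𝒜) : MeasurableSet {ω | history S A k ω = w} := by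
  simp_rw [history_eq_iff, Set.ofPred_forall]
  exact MeasurableSet.iInter fun i => h.measurableSet_pair i (w i)

/-- The path laws of lengths `k` and `k + 1` share all factors but the last. No division occurs, so
null histories need no separate treatment. -/
theorem IsTrajectory.measureReal_history_succ (h : IsTrajectory M b P S A) (k : ℕ)
    (w : Fin (k + 1) → 𝒮 × 𝒜) (z : 𝒮 × 𝒜) :
    P.real {ω | (history S A k ω, (S (k + 1) ω, A (k + 1) ω)) = (w, z)} =
      P.real {ω | history S A k ω = w} * pairChain M b (w (Fin.last k)) z := by
  set y : ℕ → 𝒮 × 𝒜 := fun i => if hi : i < k + 1 then w ⟨i, hi⟩ else z with hy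
  have hyw : ∀ i (hi : i < k + 1), y i = w ⟨i, hi⟩ := fun i hi => dif_pos hi
  have hyz : y (k + 1) = z := by simp [hy]
  have hhist : ∀ ω, history S A k ω = w ↔ ∀ i ≤ k, (S i ω, A i ω) = y i := by
    intro ω
    rw [history_eq_iff]
    constructor
    · intro hw i hi
      rw [hyw i (by omega)]
      exact hw ⟨i, by omega⟩
    · intro hw i
      rw [hw i (by omega), hyw i i.2]
  have e1 : {ω | history S A k ω = w} = {ω | ∀ i ≤ k, (S i ω, A i ω) = y i} :=
    Set.ext hhist
  have e2 : {ω | (history S A k ω, (S (k + 1) ω, A (k + 1) ω)) = (w, z)} =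
      {ω | ∀ i ≤ k + 1, (S i ω, A i ω) = y i} := by
    ext ω
    simp only [Set.mem_ofPred_eq, Prod.mk.injEq (history S A k ω)]
    rw [hhist]
    constructor
    · rintro ⟨h1, h2⟩ i hi
      rcases Nat.lt_or_ge i (k + 1) with hlt | hge
      · exact h1 i (by omega)
      · obtain rfl : i = k + 1 := by omega
        rw [hyz]; exact h2
    · intro h1
      exact ⟨fun i hi => h1 i (by omega), by rw [h1 (k + 1) le_rfl, hyz]⟩
  rw [e1, e2, h.path_law, h.path_law, Finset.prod_range_succ, hyz, hyw k (by omega), mul_assoc]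
  rfl

/-- The Markov property: averaging over the next pair given the history. -/
theorem IsTrajectory.integral_next [IsFiniteMeasure P] (h : IsTrajectory M b P S A) (k : ℕ)
    (F : (Fin (k + 1) → 𝒮 × 𝒜) → 𝒮 × 𝒜 → ℝ) :
    ∫ ω, F (history S A k ω) (S (k + 1) ω, A (k + 1) ω) ∂P =
      ∫ ω, ∑ z, pairChain M b (S k ω, A k ω) z * F (history S A k ω) z ∂P := by
  classical
  have hmeas : ∀ x : (Fin (k + 1) → 𝒮 × 𝒜) × (𝒮 × 𝒜),
      MeasurableSet {ω | (history S A k ω, (S (k + 1) ω, A (k + 1) ω)) = x} := by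
    intro x
    have : {ω | (history S A k ω, (S (k + 1) ω, A (k + 1) ω)) = x} =
        {ω | history S A k ω = x.1} ∩ {ω | (S (k + 1) ω, A (k + 1) ω) = x.2} := by
      ext ω
      rw [Set.mem_ofPred_eq, Prod.ext_iff]
      rfl
    rw [this]
    exact (h.measurableSet_history k x.1).inter (h.measurableSet_pair (k + 1) x.2)
  have e1 := integral_comp_of_finite (P := P) hmeas fun x => F x.1 x.2
  have e2 := integral_comp_of_finite (P := P) (h.measurableSet_history k)
    fun w => ∑ z, pairChain M b (w (Fin.last k)) z * F w z
  refine e1.trans (Eq.trans ?_ e2.symm)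
  rw [Fintype.sum_prod_type]
  refine Finset.sum_congr rfl fun w _ => ?_
  rw [Finset.mul_sum]
  refine Finset.sum_congr rfl fun z _ => ?_
  rw [h.measureReal_history_succ, mul_assoc]

variable [Nonempty 𝒜] [DecidableEq 𝒮] [DecidableEq 𝒜]

theorem IsTrajectory.integrable_iterate [IsFiniteMeasure P] (h : IsTrajectory M b P S A)
    (α : ℕ → ℝ) (Q₀ : 𝒮 × 𝒜 → ℝ) (k : ℕ) (G : (𝒮 × 𝒜 → ℝ) → 𝒮 × 𝒜 → ℝ) :
    Integrable (fun ω => G (iterate M α Q₀ (fun i => S i ω) (fun i => A i ω) k)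
      (S k ω, A k ω)) P := by
  obtain ⟨f, hf⟩ := exists_iterate_eq M α Q₀ S A k
  simp_rw [hf]
  exact integrable_comp_of_finite (h.measurableSet_history k) fun w => G (f w) (w (Fin.last k))

theorem IsTrajectory.integral_iterate_succ [IsFiniteMeasure P] (h : IsTrajectory M b P S A)
    (α : ℕ → ℝ) (Q₀ : 𝒮 × 𝒜 → ℝ) (k : ℕ) (G : (𝒮 × 𝒜 → ℝ) → 𝒮 × 𝒜 → ℝ) :
    ∫ ω, G (iterate M α Q₀ (fun i => S i ω) (fun i => A i ω) (k + 1))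
        (S (k + 1) ω, A (k + 1) ω) ∂P =
      ∫ ω, ∑ z, pairChain M b (S k ω, A k ω) z *
        G (update M (α k) (iterate M α Q₀ (fun i => S i ω) (fun i => A i ω) k)
          (S k ω, A k ω) z.1) z ∂P := by
  obtain ⟨f, hf⟩ := exists_iterate_eq M α Q₀ S A k
  simp_rw [iterate_succ, hf]
  exact h.integral_next k fun w z => G (update M (α k) (f w) (w (Fin.last k)) z.1) z

/-- A pointwise drift inequality gives a recursion for the expectations. -/
theorem IsTrajectory.integral_le_of_drift [IsProbabilityMeasure P] (h : IsTrajectory M b P S A)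
    (α : ℕ → ℝ) (Q₀ : 𝒮 × 𝒜 → ℝ) (k : ℕ) {G G' : (𝒮 × 𝒜 → ℝ) → 𝒮 × 𝒜 → ℝ} {r c : ℝ}
    (hdrift : ∀ Q y, ∑ z, pairChain M b y z * G' (update M (α k) Q y z.1) z ≤ r * G Q y + c) :
    ∫ ω, G' (iterate M α Q₀ (fun i => S i ω) (fun i => A i ω) (k + 1))
        (S (k + 1) ω, A (k + 1) ω) ∂P ≤
      r * ∫ ω, G (iterate M α Q₀ (fun i => S i ω) (fun i => A i ω) k) (S k ω, A k ω) ∂P + c := by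
  have hG := h.integrable_iterate α Q₀ k G
  rw [h.integral_iterate_succ, ← integral_const_mul]
  have hc : c = ∫ _ω : Ω, c ∂P := by simp
  rw [hc, ← integral_add (hG.const_mul r) (integrable_const c)]
  refine integral_mono ?_ ((hG.const_mul r).add (integrable_const c)) fun ω => ?_
  · exact h.integrable_iterate α Q₀ k fun Q y =>
      ∑ z, pairChain M b y z * G' (update M (α k) Q y z.1) z
  · exact hdrift _ _

end Trajectory

/-! ### Choice of the exponent and numerical bounds on the constants -/

section Constants

/-- With `m = ⌈log n / η⌉` one has `n^(1/(2m)) ≤ exp(η/2) ≤ (1 - η/2)⁻¹`, and `1 - η ≤ (1 - η/2)²`.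
The last bound uses `log n / η ≥ 2 log 2` to absorb the rounding up. -/
theorem exists_lyapunov_exponent {n η : ℝ} (hn : 2 ≤ n) (hη : 0 < η) (hη1 : η ≤ 1 / 2) :
    ∃ m : ℕ, 2 ≤ m ∧ n ^ (1 / (2 * m) : ℝ) * (1 - η) ≤ 1 - η / 2 ∧
      (n ^ (1 / (2 * m) : ℝ)) ^ 2 ≤ 16 / 9 ∧
      (4 * m - 3) * (n ^ (1 / (2 * m) : ℝ)) ^ 2 ≤ 10 * (Real.log n / η) := by
  have hlog2 := Real.log_two_gt_d9
  have hlog : Real.log 2 ≤ Real.log n := Real.log_le_log (by norm_num) hn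
  have hq : 1.38 ≤ Real.log n / η := by
    rw [le_div_iff₀ hη]
    nlinarith
  set q := Real.log n / η with hqdef
  have h1 : q ≤ ⌈q⌉₊ := Nat.le_ceil q
  have h2 : (⌈q⌉₊ : ℝ) < q + 1 := Nat.ceil_lt_add_one (by linarith)
  have hm : 2 ≤ ⌈q⌉₊ := by
    have : 1 < ⌈q⌉₊ := by rw [Nat.lt_ceil]; push_cast; linarith
    omega
  generalize ⌈q⌉₊ = m at h1 h2 hm
  have hm1 : (2 : ℝ) ≤ m := by exact_mod_cast hm
  refine ⟨m, hm, ?_⟩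
  have hx : n ^ (1 / (2 * m) : ℝ) ≤ (1 - η / 2)⁻¹ := by
    have he : n ^ (1 / (2 * m) : ℝ) ≤ Real.exp (η / 2) := by
      rw [Real.rpow_def_of_pos (by linarith)]
      refine Real.exp_le_exp.2 ?_
      rw [mul_one_div, div_le_iff₀ (by linarith)]
      rw [hqdef, div_le_iff₀ hη] at h1
      linarith
    refine he.trans ?_
    rw [← neg_neg (η / 2), Real.exp_neg]
    refine inv_anti₀ (by linarith) ?_
    have := Real.add_one_le_exp (-(η / 2))
    linarith
  have h0 : 0 ≤ n ^ (1 / (2 * m) : ℝ) := Real.rpow_nonneg (by linarith) _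
  generalize n ^ (1 / (2 * m) : ℝ) = c at hx h0 ⊢
  have hpos : 0 < 1 - η / 2 := by linarith
  have hc : c * (1 - η / 2) ≤ 1 := by
    rwa [← le_div_iff₀ hpos, one_div]
  have hc43 : c ≤ 4 / 3 := by nlinarith
  have hc2 : c ^ 2 ≤ 16 / 9 := by nlinarith
  refine ⟨?_, hc2, ?_⟩
  · nlinarith [mul_le_mul_of_nonneg_right hc hpos.le, mul_nonneg h0 (sq_nonneg η)]
  · have h3 := mul_le_mul_of_nonneg_left hc2 (by linarith : (0 : ℝ) ≤ 4 * m - 3)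
    linarith

theorem omega_bounds {η : ℝ} (hη : 0 < η) (hη1 : η ≤ 1 / 2) :
    0 < (1 / 2 + 1 / (2 * (1 - η))) ^ 2 - 1 ∧
      9 / 10 / η ≤ (1 + ((1 / 2 + 1 / (2 * (1 - η))) ^ 2 - 1)) /
        ((1 / 2 + 1 / (2 * (1 - η))) ^ 2 - 1) ∧
      (1 + ((1 / 2 + 1 / (2 * (1 - η))) ^ 2 - 1)) /
        ((1 / 2 + 1 / (2 * (1 - η))) ^ 2 - 1) ≤ 1 / η := by
  have h1 : (0 : ℝ) < 1 - η := by linarith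
  have e1 : (1 / 2 + 1 / (2 * (1 - η))) ^ 2 - 1 = η * (4 - 3 * η) / (4 * (1 - η) ^ 2) := by
    field_simp
    ring
  have e2 : 1 + η * (4 - 3 * η) / (4 * (1 - η) ^ 2) = (2 - η) ^ 2 / (4 * (1 - η) ^ 2) := by
    field_simp
    ring
  have h2 : 0 < η * (4 - 3 * η) := mul_pos hη (by linarith)
  have h3 : 0 < 4 * (1 - η) ^ 2 := by positivity
  rw [e1, e2, div_div_div_cancel_right₀ h3.ne']
  refine ⟨div_pos h2 h3, ?_, ?_⟩
  · rw [div_le_div_iff₀ hη h2]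
    have h4 : 9 / 10 * (4 - 3 * η) ≤ (2 - η) ^ 2 := by
      -- The difference of the two sides factors exactly as `(1/2 - η)(4/5 - η)`.
      nlinarith [mul_nonneg (by linarith : 0 ≤ 1 / 2 - η) (by linarith : 0 ≤ 4 / 5 - η)]
    linarith [mul_le_mul_of_nonneg_right h4 hη.le]
  · rw [div_le_div_iff₀ h2 hη]
    have h4 : (2 - η) ^ 2 ≤ 4 - 3 * η := by nlinarith
    linarith [mul_le_mul_of_nonneg_right h4 hη.le]

variable {𝒮 𝒜 : Type*} [Fintype 𝒮] [Fintype 𝒜]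

theorem two_le_numPairs (hcard : 2 ≤ Fintype.card 𝒮 * Fintype.card 𝒜) : 2 ≤ numPairs 𝒮 𝒜 := by
  unfold numPairs
  exact_mod_cast hcard

theorem numPairs_rpow (hcard : 2 ≤ Fintype.card 𝒮 * Fintype.card 𝒜) :
    numPairs 𝒮 𝒜 ^ (2 / pExp 𝒮 𝒜) = Real.exp 1 := by
  have hn := two_le_numPairs hcard
  have hl : 0 < Real.log (numPairs 𝒮 𝒜) := Real.log_pos (by linarith)
  rw [Real.rpow_def_of_pos (by linarith), pExp]
  congr 1
  field_simp

/-- Compare `B(Q*) = Q*` with `B(0)`, which is the reward. -/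
theorem norm_Qstar_le [Nonempty 𝒜] {M : FiniteMDP 𝒮 𝒜} {r : ℝ} (hr : 0 ≤ r) (hR : ∀ s a, |M.reward s a| ≤ r) :
    (1 - M.disc) * ‖Qstar M‖ ≤ r := by
  have hγ := M.disc_pos
  have h : ‖Qstar M‖ ≤ r + M.disc * ‖Qstar M‖ := by
    refine (pi_norm_le_iff_of_nonneg (by positivity)).2 fun w => ?_
    have h1 := abs_bellman_sub_le M (Qstar M) 0 w
    rw [bellman_Qstar, sub_zero] at h1
    have h2 : bellman M 0 w = M.reward w.1 w.2 := by
      simp [bellman, maxQ]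
    rw [h2] at h1
    have h3 := hR w.1 w.2
    rw [Real.norm_eq_abs]
    have h4 := abs_sub_abs_le_abs_sub (Qstar M w) (M.reward w.1 w.2)
    linarith
  linarith

variable [Nonempty 𝒮] [Nonempty 𝒜] {M : FiniteMDP 𝒮 𝒜} {b : Policy 𝒮 𝒜} {μ : 𝒮 → ℝ}

theorem eta_pos (hΛ : 0 < minOcc b μ) : 0 < eta M b μ :=
  mul_pos (by linarith [M.disc_lt_one]) hΛ

theorem minOcc_le_half (hcard : 2 ≤ Fintype.card 𝒮 * Fintype.card 𝒜)
    (hμ : IsStationary M b μ) (hΛ : 0 < minOcc b μ) : minOcc b μ ≤ 1 / 2 := by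
  have h1 := numPairs_mul_minOcc_le hμ
  have h2 := two_le_numPairs hcard
  nlinarith

theorem eta_le_half (hcard : 2 ≤ Fintype.card 𝒮 * Fintype.card 𝒜)
    (hμ : IsStationary M b μ) (hΛ : 0 < minOcc b μ) : eta M b μ ≤ 1 / 2 := by
  have h1 := minOcc_le_half hcard hμ hΛ
  have h2 := M.disc_pos
  unfold eta
  nlinarith

variable [DecidableEq 𝒮] [DecidableEq 𝒜] {y₀ : 𝒮 × 𝒜}

/-- The lower bound lets `ϱ_{Q,1}` absorb the Lipschitz constant times `τ`; the upper bound turns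
rates into a sample complexity. -/
theorem rho1_bounds (hcard : 2 ≤ Fintype.card 𝒮 * Fintype.card 𝒜) (hη : 0 < eta M b μ)
    (hη1 : eta M b μ ≤ 1 / 2) (hτ : 1 ≤ maxHitting M b y₀) :
    10 * (maxHitting M b y₀ * Real.log (numPairs 𝒮 𝒜) / eta M b μ) ≤ rho1 M b μ y₀ ∧
      rho1 M b μ y₀ ≤
        16 * Real.exp 1 * maxHitting M b y₀ * Real.log (numPairs 𝒮 𝒜) / eta M b μ := by
  have hn := two_le_numPairs hcard
  have hlog2 := Real.log_two_gt_d9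
  have hlog : Real.log 2 ≤ Real.log (numPairs 𝒮 𝒜) := Real.log_le_log (by norm_num) hn
  have he := Real.exp_one_gt_d9
  obtain ⟨-, hω1, hω2⟩ := omega_bounds hη hη1
  have e : rho1 M b μ y₀ = (1 + omegaQ M b μ) / omegaQ M b μ *
      (8 * Real.exp 1 * maxHitting M b y₀ * (2 * Real.log (numPairs 𝒮 𝒜) - 1)) := by
    rw [rho1, numPairs_rpow hcard, pExp]
    ring
  change _ ≤ (1 + omegaQ M b μ) / omegaQ M b μ at hω1
  change (1 + omegaQ M b μ) / omegaQ M b μ ≤ _ at hω2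
  generalize (1 + omegaQ M b μ) / omegaQ M b μ = c at *
  rw [e]
  set ℓ := Real.log (numPairs 𝒮 𝒜)
  set τ := maxHitting M b y₀
  set η := eta M b μ
  have h1 : 11.5 * (τ * ℓ) ≤ 8 * Real.exp 1 * τ * (2 * ℓ - 1) := by
    -- This needs `ℓ ≥ 0.682`, only just below `log 2`. The value `11.5` leaves `10` after the
    -- factor `9/10` from `ω`.
    have : 11.5 * ℓ ≤ 8 * 2.7 * (2 * ℓ - 1) := by linarith
    calc 11.5 * (τ * ℓ) = τ * (11.5 * ℓ) := by ring
      _ ≤ τ * (8 * 2.7 * (2 * ℓ - 1)) := mul_le_mul_of_nonneg_left this (by linarith)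
      _ = 8 * 2.7 * (τ * (2 * ℓ - 1)) := by ring
      _ ≤ 8 * Real.exp 1 * (τ * (2 * ℓ - 1)) := by
          refine mul_le_mul_of_nonneg_right (by linarith) (mul_nonneg ?_ ?_) <;> linarith
      _ = _ := by ring
  have hτℓ : 0 ≤ τ * ℓ := mul_nonneg (by linarith) (by linarith)
  have h2 : 8 * Real.exp 1 * τ * (2 * ℓ - 1) ≤ 16 * Real.exp 1 * τ * ℓ := by
    nlinarith [mul_nonneg (by linarith : 0 ≤ Real.exp 1) (by linarith : 0 ≤ τ)]
  constructor
  · calc 10 * (τ * ℓ / η) ≤ 9 / 10 / η * (11.5 * (τ * ℓ)) := by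
          rw [div_mul_eq_mul_div, mul_div_assoc', div_le_div_iff_of_pos_right hη]
          linarith
      _ ≤ c * (8 * Real.exp 1 * τ * (2 * ℓ - 1)) :=
          mul_le_mul hω1 h1 (by linarith) (le_trans (by positivity) hω1)
  · calc c * (8 * Real.exp 1 * τ * (2 * ℓ - 1)) ≤ 1 / η * (16 * Real.exp 1 * τ * ℓ) :=
          mul_le_mul hω2 h2 (by linarith) (by positivity)
      _ = _ := by ring

theorem ten_le_rho1 (hcard : 2 ≤ Fintype.card 𝒮 * Fintype.card 𝒜) (hη : 0 < eta M b μ)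
    (hη1 : eta M b μ ≤ 1 / 2) (hτ : 1 ≤ maxHitting M b y₀) : 10 ≤ rho1 M b μ y₀ := by
  refine le_trans ?_ (rho1_bounds hcard hη hη1 hτ).1
  have hn := two_le_numPairs hcard
  have hlog2 := Real.log_two_gt_d9
  have hlog : Real.log 2 ≤ Real.log (numPairs 𝒮 𝒜) := Real.log_le_log (by norm_num) hn
  have : 1 ≤ maxHitting M b y₀ * Real.log (numPairs 𝒮 𝒜) / eta M b μ := by
    rw [le_div_iff₀ hη]
    nlinarith
  linarith

theorem rho0_bounds (Q₀ : 𝒮 × 𝒜 → ℝ) (hη : 0 < eta M b μ) (hη1 : eta M b μ ≤ 1 / 2)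
    (hρ : 0 ≤ rho1 M b μ y₀) :
    2 * ‖Q₀ - Qstar M‖ ^ 2 ≤ rho0 M b μ y₀ Q₀ ∧
      rho0 M b μ y₀ Q₀ ≤ 4 * (1 + 50 * rho1 M b μ y₀) * ‖Q₀ - Qstar M‖ ^ 2 +
        36 * ‖Qstar M‖ ^ 2 * rho1 M b μ y₀ := by
  have hω : 0 < omegaQ M b μ := (omega_bounds hη hη1).1
  have he := Real.exp_one_gt_d9
  have he2 := Real.exp_one_lt_d9
  have hs1 : 1 ≤ Real.sqrt (Real.exp 1) := Real.one_le_sqrt.2 (by linarith)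
  have hs2 : Real.sqrt (Real.exp 1) ≤ 2 := by
    rw [Real.sqrt_le_left (by norm_num)]
    linarith
  unfold rho0
  set ρ := rho1 M b μ y₀
  set ω := omegaQ M b μ
  have hd1 : ω / Real.sqrt (Real.exp 1) ≤ ω := div_le_self hω.le hs1
  have hd2 : ω / 2 ≤ ω / Real.sqrt (Real.exp 1) :=
    div_le_div_of_nonneg_left hω.le (by linarith) hs2
  have hpos : 0 < 1 + ω / Real.sqrt (Real.exp 1) := by positivity
  have hx : 0 ≤ ‖Q₀ - Qstar M‖ ^ 2 := by positivity
  constructor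
  · have h1 : 2 ≤ 2 * (1 + ω) * (1 + 50 * ρ) / (1 + ω / Real.sqrt (Real.exp 1)) := by
      rw [le_div_iff₀ hpos]
      nlinarith [mul_nonneg hω.le hρ]
    have h2 := mul_le_mul_of_nonneg_right h1 hx
    have h3 : 0 ≤ 36 * ‖Qstar M‖ ^ 2 * ρ := by positivity
    linarith
  · have h1 : 2 * (1 + ω) * (1 + 50 * ρ) / (1 + ω / Real.sqrt (Real.exp 1)) ≤
        4 * (1 + 50 * ρ) := by
      rw [div_le_iff₀ hpos]
      have : 1 + ω ≤ 2 * (1 + ω / Real.sqrt (Real.exp 1)) := by linarith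
      nlinarith
    have h2 := mul_le_mul_of_nonneg_right h1 hx
    linarith

end Constants

/-! ### Scalar affine recursions -/

section Recursions

/-- `c / q` is the fixed point of the recursion, and `1 - q ≤ exp(-q)`. -/
theorem recursion_const {u : ℕ → ℝ} {q c u₀ : ℝ} (hq0 : 0 < q) (hq1 : q ≤ 1) (hu0 : u 0 ≤ u₀)
    (hu₀ : 0 ≤ u₀) (hc : 0 ≤ c) (hu : ∀ k, u (k + 1) ≤ (1 - q) * u k + c) (k : ℕ) :
    u k ≤ u₀ * Real.exp (-(q * k)) + c / q := by
  induction k with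
  | zero =>
    have : 0 ≤ c / q := by positivity
    simp only [Nat.cast_zero, mul_zero, neg_zero, Real.exp_zero, mul_one]
    linarith
  | succ k ih =>
    have h1 : 1 - q ≤ Real.exp (-q) := by
      have := Real.add_one_le_exp (-q)
      linarith
    have e : Real.exp (-(q * (k + 1 : ℕ))) = Real.exp (-q) * Real.exp (-(q * k)) := by
      rw [← Real.exp_add]
      congr 1
      push_cast
      ring
    rw [e]
    have h2 := mul_le_mul_of_nonneg_left ih (by linarith : 0 ≤ 1 - q)
    have h3 := mul_le_mul_of_nonneg_right h1
      (mul_nonneg hu₀ (Real.exp_pos (-(q * k))).le)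
    have h4 : (1 - q) * (c / q) + c = c / q := by
      field_simp
      ring
    calc u (k + 1) ≤ (1 - q) * (u₀ * Real.exp (-(q * k)) + c / q) + c := by linarith [hu k]
      _ = (1 - q) * (u₀ * Real.exp (-(q * k))) + ((1 - q) * (c / q) + c) := by ring
      _ ≤ _ := by rw [h4]; linarith

/-- With `t = k + K`, the transient telescopes since `1 - a/t ≤ (t/(t+1))^a`. The noise term
propagates since `(1 - a/t)/t + (a-1)/t² = (t-1)/t² ≤ 1/(t+1)`. -/
theorem recursion_dimin {u : ℕ → ℝ} {a c u₀ K : ℝ} (ha : 1 < a) (haK : a ≤ K) (hu0 : u 0 ≤ u₀)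
    (hu₀ : 0 ≤ u₀) (hc : 0 ≤ c)
    (hu : ∀ k : ℕ, u (k + 1) ≤ (1 - a / (k + K)) * u k + c / (k + K) ^ 2) (k : ℕ) :
    u k ≤ u₀ * (K / (k + K)) ^ a + c / ((a - 1) * (k + K)) := by
  have hK : 0 < K := by linarith
  have ha1 : 0 < a - 1 := by linarith
  induction k with
  | zero =>
    have : 0 ≤ c / ((a - 1) * K) := by positivity
    simp only [Nat.cast_zero, zero_add, div_self hK.ne', Real.one_rpow, mul_one]
    linarith
  | succ k ih =>
    have ht : 0 < (k : ℝ) + K := by positivity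
    have hta : a ≤ k + K := by linarith [(Nat.cast_nonneg k : (0 : ℝ) ≤ k)]
    push_cast
    rw [show (k : ℝ) + 1 + K = (k + K) + 1 by ring]
    specialize hu k
    generalize (k : ℝ) + K = t at *
    have hr : 0 ≤ 1 - a / t := by
      rw [sub_nonneg, div_le_one ht]
      exact hta
    have h1 : (1 - a / t) * (K / t) ^ a ≤ (K / (t + 1)) ^ a := by
      have e : K / (t + 1) = K / t * (t / (t + 1)) := by field_simp
      rw [e, Real.mul_rpow (by positivity) (by positivity), mul_comm]
      refine mul_le_mul_of_nonneg_left ?_ (by positivity)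
      have h2 : Real.exp (-(1 / t)) ≤ t / (t + 1) := by
        rw [Real.exp_neg, inv_le_comm₀ (Real.exp_pos _) (by positivity), inv_div]
        have := Real.add_one_le_exp (1 / t)
        rw [add_div, div_self ht.ne']
        linarith
      calc 1 - a / t ≤ Real.exp (-(a / t)) := by
            have := Real.add_one_le_exp (-(a / t))
            linarith
        _ = Real.exp (-(1 / t)) ^ a := by
            rw [← Real.exp_mul]
            congr 1
            ring
        _ ≤ (t / (t + 1)) ^ a := Real.rpow_le_rpow (Real.exp_pos _).le h2 (by linarith)
    have h3 : (1 - a / t) * (c / ((a - 1) * t)) + c / t ^ 2 ≤ c / ((a - 1) * (t + 1)) := by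
      have e : (1 - a / t) * (c / ((a - 1) * t)) + c / t ^ 2 =
          c / (a - 1) * ((t - 1) / t ^ 2) := by
        field_simp
        ring
      rw [e, ← div_div]
      rw [div_eq_mul_one_div (c / (a - 1)) (t + 1)]
      refine mul_le_mul_of_nonneg_left ?_ (by positivity)
      rw [div_le_div_iff₀ (by positivity) (by positivity)]
      nlinarith
    have h4 := mul_le_mul_of_nonneg_left ih hr
    have h5 := mul_le_mul_of_nonneg_left h1 hu₀
    calc u (k + 1) ≤ (1 - a / t) * (u₀ * (K / t) ^ a + c / ((a - 1) * t)) + c / t ^ 2 := by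
          linarith
      _ = u₀ * ((1 - a / t) * (K / t) ^ a) +
          ((1 - a / t) * (c / ((a - 1) * t)) + c / t ^ 2) := by ring
      _ ≤ _ := add_le_add h5 h3

end Recursions

/-! ### Finite-time bounds and sample complexity -/

section Main

variable {𝒮 𝒜 : Type*} [Fintype 𝒮] [Fintype 𝒜] [DecidableEq 𝒮] [DecidableEq 𝒜]
  [Nonempty 𝒮] [Nonempty 𝒜] {M : FiniteMDP 𝒮 𝒜} {b : Policy 𝒮 𝒜} {μ : 𝒮 → ℝ}
  {Ω : Type*} [MeasurableSpace Ω] {P : Measure Ω} [IsProbabilityMeasure P]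
  {S : ℕ → Ω → 𝒮} {A : ℕ → Ω → 𝒜} {y₀ : 𝒮 × 𝒜}

/-- For slowly varying small step sizes the mean square error is dominated by a sequence that
satisfies an affine recursion. -/
theorem exists_lyapunov_recursion (hcard : 2 ≤ Fintype.card 𝒮 * Fintype.card 𝒜)
    (hpos : ∀ s a, 0 < b.prob s a) (hirr : (stateChain M b).IsIrreducible)
    (htraj : IsTrajectory M b P S A) (Q₀ : 𝒮 × 𝒜 → ℝ) (hμ : IsStationary M b μ)
    {α : ℕ → ℝ} (hα : ∀ k, 0 ≤ α k) (hαρ : ∀ k, 125 * (α k * rho1 M b μ y₀) ≤ eta M b μ)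
    (hle : ∀ k, α (k + 1) ≤ α k) (hsub : ∀ k, α k - α (k + 1) ≤ α k ^ 2 / 4) :
    ∃ u : ℕ → ℝ, u 0 ≤ 0.91 * ‖Q₀ - Qstar M‖ ^ 2 ∧
      (∀ k, u (k + 1) ≤ (1 - α k * eta M b μ / 2) * u k +
        30 * rho1 M b μ y₀ * ‖Qstar M‖ ^ 2 * α k ^ 2) ∧
      ∀ k, Integrable (fun ω => err M α Q₀ S A k ω ^ 2) P ∧
        ∫ ω, err M α Q₀ S A k ω ^ 2 ∂P ≤ 2.04 * u k := by
  have hΛ := minOcc_pos hpos hirr hμ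
  have hη := eta_pos (M := M) hΛ
  have hη1 := eta_le_half hcard hμ hΛ
  have hτ := one_le_maxHitting (y₀ := y₀) hpos hirr hcard
  have hρ10 := ten_le_rho1 (y₀ := y₀) hcard hη hη1 hτ
  obtain ⟨m, hm, hroot, hκ, hL⟩ := exists_lyapunov_exponent (two_le_numPairs hcard) hη hη1
  have hrc : rootCard (𝒮 × 𝒜) m = numPairs 𝒮 𝒜 ^ (1 / (2 * m) : ℝ) := by
    rw [rootCard, numPairs, Fintype.card_prod]
    push_cast
    rfl
  rw [← hrc] at hroot hκ hL
  have hΛpos : ∀ w, 0 < occ b μ w := fun w => hΛ.trans_le (minOcc_le_occ b μ w)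
  have hΛ1 : ∀ w, occ b μ w ≤ 1 := fun w => by
    rw [← sum_occ hμ]
    exact Finset.single_le_sum (fun y _ => (hΛpos y).le) (Finset.mem_univ w)
  obtain ⟨v, hv, hpoisson⟩ := exists_poisson (y₀ := y₀) (pairChain_nonneg M b)
    (summable_survival_pairChain hpos hirr) hΛpos (sum_occ hμ) (occ_invariant hμ)
    (tsum_survival_le_maxHitting hpos hirr)
  have hρ : maxHitting M b y₀ * ((4 * m - 3) * rootCard (𝒮 × 𝒜) m ^ 2) ≤ rho1 M b μ y₀ := by
    refine le_trans ?_ (rho1_bounds hcard hη hη1 hτ).1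
    refine (mul_le_mul_of_nonneg_left hL (by linarith)).trans (le_of_eq ?_)
    ring
  have hα1 : ∀ k, α k ≤ 1 / 1000 := by
    intro k
    have := mul_le_mul_of_nonneg_left hρ10 (hα k)
    linarith [hαρ k]
  have hclose : ∀ k Q y, |corrected m M v (α k) Q y - lyap m (Q - Qstar M)| ≤
      0.016 * lyap m (Q - Qstar M) := by
    intro k Q y
    refine (abs_corrected_sub_le hm hv hτ hρ (hα k) Q y).trans ?_
    refine mul_le_mul_of_nonneg_right ?_ (lyap_nonneg _ _)
    linarith [hαρ k]
  -- The corrected function is within `1.6%` of `lyap`. Hence `0.91 ≥ 1.016 · (16/9) / 2` at the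
  -- start and `2.04 ≥ 2 / 0.984` when returning to the sup norm; their product stays below the `2`
  -- of `rho0_bounds`.
  refine ⟨fun k => ∫ ω, corrected m M v (α k)
    (iterate M α Q₀ (fun i => S i ω) (fun i => A i ω) k) (S k ω, A k ω) ∂P, ?_, ?_, ?_⟩
  · have hb : ∀ ω, corrected m M v (α 0)
        (iterate M α Q₀ (fun i => S i ω) (fun i => A i ω) 0) (S 0 ω, A 0 ω) ≤
          0.91 * ‖Q₀ - Qstar M‖ ^ 2 := by
      intro ω
      change corrected m M v (α 0) Q₀ _ ≤ _
      have h1 := (abs_le.1 (hclose 0 Q₀ (S 0 ω, A 0 ω))).2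
      have h2 := lyap_le_norm_sq (m := m) (by omega) (Q₀ - Qstar M)
      have h3 := mul_le_mul_of_nonneg_right hκ (sq_nonneg ‖Q₀ - Qstar M‖)
      linarith [sq_nonneg ‖Q₀ - Qstar M‖]
    refine (integral_mono (htraj.integrable_iterate α Q₀ 0 (corrected m M v (α 0)))
      (integrable_const _) hb).trans (le_of_eq ?_)
    simp
  · intro k
    exact htraj.integral_le_of_drift α Q₀ k (G := corrected m M v (α k))
      (G' := corrected m M v (α (k + 1))) fun Q y =>
        sum_pairChain_mul_corrected_le hm (minOcc_le_occ b μ) (fun w => (hΛpos w).le) hΛ1 rfl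
          hη.le hη1 hroot hv hτ hpoisson hρ (hα k) (hα1 k) (hαρ k) (hle k) (hsub k) Q y
  · intro k
    have hint := htraj.integrable_iterate α Q₀ k fun Q _ => ‖Q - Qstar M‖ ^ 2
    refine ⟨hint, ?_⟩
    rw [← integral_const_mul]
    refine integral_mono hint
      ((htraj.integrable_iterate α Q₀ k (corrected m M v (α k))).const_mul _) fun ω => ?_
    set Q := iterate M α Q₀ (fun i => S i ω) (fun i => A i ω) k
    have h1 := (abs_le.1 (hclose k Q (S k ω, A k ω))).1
    have h2 := norm_sq_le_lyap (m := m) (by omega) (Q - Qstar M)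
    have h3 := lyap_nonneg m (Q - Qstar M)
    change ‖Q - Qstar M‖ ^ 2 ≤ 2.04 * corrected m M v (α k) Q (S k ω, A k ω)
    linarith

theorem integral_err_sq_le_of_const (hcard : 2 ≤ Fintype.card 𝒮 * Fintype.card 𝒜)
    (hpos : ∀ s a, 0 < b.prob s a) (hirr : (stateChain M b).IsIrreducible)
    (htraj : IsTrajectory M b P S A) (Q₀ : 𝒮 × 𝒜 → ℝ) (hμ : IsStationary M b μ)
    {α : ℝ} (hα : 0 < α)
    (hαle : α ≤ eta M b μ / (constA * (5 + 2 * eta M b μ) * rho1 M b μ y₀)) (k : ℕ) :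
    Integrable (fun ω => err M (fun _ => α) Q₀ S A k ω ^ 2) P ∧
      ∫ ω, err M (fun _ => α) Q₀ S A k ω ^ 2 ∂P ≤
        rho0 M b μ y₀ Q₀ * Real.exp (-eta M b μ * α * k / 2) +
          58 * constB M * rho1 M b μ y₀ * α / eta M b μ := by
  have hΛ := minOcc_pos hpos hirr hμ
  have hη := eta_pos (M := M) hΛ
  have hη1 := eta_le_half hcard hμ hΛ
  have hρ10 := ten_le_rho1 (y₀ := y₀) hcard hη hη1 (one_le_maxHitting hpos hirr hcard)
  have hρ0 := (rho0_bounds (y₀ := y₀) Q₀ hη hη1 (by linarith)).1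
  have hαρ : 125 * (α * rho1 M b μ y₀) ≤ eta M b μ := by
    have hd : 0 < constA * (5 + 2 * eta M b μ) * rho1 M b μ y₀ := by
      unfold constA
      exact mul_pos (by linarith) (by linarith)
    rw [le_div_iff₀ hd, constA] at hαle
    nlinarith [mul_pos (mul_pos hα hη) (by linarith : 0 < rho1 M b μ y₀)]
  obtain ⟨u, hu0, hu, herr⟩ := exists_lyapunov_recursion (α := fun _ => α) (y₀ := y₀) hcard hpos
    hirr htraj Q₀ hμ (fun _ => hα.le) (fun _ => hαρ) (fun _ => le_rfl)
    (fun _ => by rw [sub_self]; positivity)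
  refine ⟨(herr k).1, (herr k).2.trans ?_⟩
  unfold constB
  set η := eta M b μ
  set ρ := rho1 M b μ y₀
  set D := ‖Qstar M‖
  have hq1 : α * η / 2 ≤ 1 := by nlinarith
  have hrec := recursion_const (q := α * η / 2) (by positivity) hq1 hu0 (by positivity)
    (mul_nonneg (mul_nonneg (by linarith) (sq_nonneg D)) (sq_nonneg α) :
      0 ≤ 30 * ρ * D ^ 2 * α ^ 2) hu k
  rw [show -(α * η / 2 * k) = -η * α * k / 2 by ring] at hrec
  have e : 30 * ρ * D ^ 2 * α ^ 2 / (α * η / 2) = 60 * (ρ * D ^ 2 * α / η) := by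
    field_simp
    ring
  rw [e] at hrec
  have e2 : 58 * (9 * D ^ 2) * ρ * α / η = 522 * (ρ * D ^ 2 * α / η) := by ring
  rw [e2]
  have hN : 0 ≤ ρ * D ^ 2 * α / η :=
    div_nonneg (mul_nonneg (mul_nonneg (by linarith) (sq_nonneg D)) hα.le) hη.le
  have h1 : 2.04 * (0.91 * ‖Q₀ - Qstar M‖ ^ 2) ≤ rho0 M b μ y₀ Q₀ := by
    linarith [sq_nonneg ‖Q₀ - Qstar M‖]
  have h2 := mul_le_mul_of_nonneg_right h1 (Real.exp_pos (-η * α * k / 2)).le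
  linarith

theorem integral_err_sq_le_of_dimin (hcard : 2 ≤ Fintype.card 𝒮 * Fintype.card 𝒜)
    (hpos : ∀ s a, 0 < b.prob s a) (hirr : (stateChain M b).IsIrreducible)
    (htraj : IsTrajectory M b P S A) (Q₀ : 𝒮 × 𝒜 → ℝ) (hμ : IsStationary M b μ)
    {α K : ℝ} (hα : 2 / eta M b μ < α)
    (hK : constA * α * (5 * α + 8) * rho1 M b μ y₀ ≤ K) (k : ℕ) :
    Integrable (fun ω => err M (fun n => α / (n + K)) Q₀ S A k ω ^ 2) P ∧
      ∫ ω, err M (fun n => α / (n + K)) Q₀ S A k ω ^ 2 ∂P ≤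
        rho0 M b μ y₀ Q₀ * (K / (k + K)) ^ (eta M b μ * α / 2) +
          72 * constB M * rho1 M b μ y₀ * Real.exp 1 * α ^ 2 /
            ((eta M b μ * α / 2 - 1) * (k + K)) := by
  have hΛ := minOcc_pos hpos hirr hμ
  have hη := eta_pos (M := M) hΛ
  have hη1 := eta_le_half hcard hμ hΛ
  have hρ10 := ten_le_rho1 (y₀ := y₀) hcard hη hη1 (one_le_maxHitting hpos hirr hcard)
  have hρ0 := (rho0_bounds (y₀ := y₀) Q₀ hη hη1 (by linarith)).1
  have hηα : 2 < α * eta M b μ := by rwa [div_lt_iff₀ hη] at hα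
  -- From `α > 2/η` and `η ≤ 1/2`. This makes the decrement `α/(t(t+1))` of the step size at most a
  -- quarter of its square.
  have hα4 : 4 ≤ α := by nlinarith
  have hK1 : 125 * α * (α * rho1 M b μ y₀) ≤ K := by
    unfold constA at hK
    nlinarith [mul_pos (by linarith : 0 < α) (by linarith : 0 < rho1 M b μ y₀)]
  have hαρ0 : 40 ≤ α * rho1 M b μ y₀ := by nlinarith
  have hKα : 125 * α ≤ K := by nlinarith
  have hK0 : 0 < K := by linarith
  have hkK : ∀ k : ℕ, 0 < (k : ℝ) + K := fun k => by positivity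
  have hstep : ∀ k : ℕ, 125 * (α / (k + K) * rho1 M b μ y₀) ≤ eta M b μ := by
    intro k
    have h : 125 * (α / (k + K) * rho1 M b μ y₀) = 125 * (α * rho1 M b μ y₀) / (k + K) := by ring
    rw [h, div_le_iff₀ (hkK k)]
    have h1 : 125 * (α * rho1 M b μ y₀) ≤ eta M b μ * K := by
      calc 125 * (α * rho1 M b μ y₀) ≤ (α * eta M b μ) * (125 * (α * rho1 M b μ y₀)) :=
            le_mul_of_one_le_left (by linarith) (by linarith)
        _ = eta M b μ * (125 * α * (α * rho1 M b μ y₀)) := by ring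
        _ ≤ _ := mul_le_mul_of_nonneg_left hK1 hη.le
    have h2 : eta M b μ * K ≤ eta M b μ * (k + K) :=
      mul_le_mul_of_nonneg_left (by linarith [(Nat.cast_nonneg k : (0 : ℝ) ≤ k)]) hη.le
    linarith
  obtain ⟨u, hu0, hu, herr⟩ := exists_lyapunov_recursion (α := fun n => α / (n + K)) (y₀ := y₀)
    hcard hpos hirr htraj Q₀ hμ (fun k => (div_pos (by linarith) (hkK k)).le) hstep
    (fun k => by
      push_cast
      exact div_le_div_of_nonneg_left (by linarith) (hkK k) (by linarith))
    (fun k => by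
      push_cast
      have ht := hkK k
      rw [show (k : ℝ) + 1 + K = (k + K) + 1 by ring]
      generalize (k : ℝ) + K = t at ht
      rw [div_sub_div _ _ ht.ne' (by linarith), div_pow, div_div,
        div_le_div_iff₀ (by positivity) (by positivity)]
      have h1 : α * t * (4 * t) ≤ α * t * (α * (t + 1)) := by
        refine mul_le_mul_of_nonneg_left ?_ (by positivity)
        nlinarith
      nlinarith)
  refine ⟨(herr k).1, (herr k).2.trans ?_⟩
  unfold constB
  set η := eta M b μ
  set ρ := rho1 M b μ y₀
  set D := ‖Qstar M‖
  have ha : 1 < η * α / 2 := by linarith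
  have hrec := recursion_dimin (a := η * α / 2) (K := K) ha (by nlinarith) hu0 (by positivity)
    (mul_nonneg (mul_nonneg (by linarith) (sq_nonneg D)) (sq_nonneg α) :
      0 ≤ 30 * ρ * D ^ 2 * α ^ 2) (fun k => (hu k).trans (le_of_eq (by rw [div_pow]; ring))) k
  have h1 : 2.04 * (0.91 * ‖Q₀ - Qstar M‖ ^ 2) ≤ rho0 M b μ y₀ Q₀ := by
    linarith [sq_nonneg ‖Q₀ - Qstar M‖]
  have h2 := mul_le_mul_of_nonneg_right h1
    (Real.rpow_nonneg (div_pos hK0 (hkK k)).le (η * α / 2))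
  have hd : 0 < (η * α / 2 - 1) * (k + K) := mul_pos (by linarith) (hkK k)
  have h3 : 2.04 * (30 * ρ * D ^ 2 * α ^ 2 / ((η * α / 2 - 1) * (k + K))) ≤
      72 * (9 * D ^ 2) * ρ * Real.exp 1 * α ^ 2 / ((η * α / 2 - 1) * (k + K)) := by
    rw [mul_div_assoc']
    refine div_le_div_of_nonneg_right ?_ hd.le
    have hN : 0 ≤ ρ * D ^ 2 * α ^ 2 :=
      mul_nonneg (mul_nonneg (by linarith) (sq_nonneg D)) (sq_nonneg α)
    have he := mul_le_mul_of_nonneg_right Real.exp_one_gt_d9.le hN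
    linarith
  linarith

theorem accStep_pos (hη : 0 < eta M b μ) (hρ : 0 < rho1 M b μ y₀) {r ε : ℝ} (hr : 0 < r)
    (hε : 0 < ε) : 0 < accStep M b μ y₀ r ε := by
  have := M.disc_lt_one
  have h : 0 < 1 - M.disc := by linarith
  unfold accStep
  positivity

theorem accStep_le (hη : 0 < eta M b μ) (hη1 : eta M b μ ≤ 1 / 2) (hρ : 10 ≤ rho1 M b μ y₀)
    {r ε : ℝ} (hr : 0 < r) (hε : 0 < ε) (hεr : ε * (1 - M.disc) ≤ r) :
    accStep M b μ y₀ r ε ≤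
      min 1 (eta M b μ / (constA * (5 + 2 * eta M b μ) * rho1 M b μ y₀)) := by
  have := M.disc_lt_one
  have h0 : 0 ≤ ε * (1 - M.disc) := mul_nonneg hε.le (by linarith)
  have hsq : (ε * (1 - M.disc)) ^ 2 ≤ r ^ 2 := pow_le_pow_left₀ h0 hεr 2
  have hρ0 : 0 < rho1 M b μ y₀ := by linarith
  have h1 : accStep M b μ y₀ r ε ≤ eta M b μ / (1044 * rho1 M b μ y₀) := by
    unfold accStep
    rw [div_le_div_iff₀ (by positivity) (by positivity)]
    have := mul_le_mul_of_nonneg_right hsq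
      (by positivity : 0 ≤ eta M b μ * (1044 * rho1 M b μ y₀))
    linarith
  refine h1.trans (le_min ?_ ?_)
  · rw [div_le_one (by positivity)]
    linarith
  · unfold constA
    refine div_le_div_of_nonneg_left hη.le (by positivity) ?_
    refine mul_le_mul_of_nonneg_right ?_ hρ0.le
    linarith

/-- The number of steps in `sampleScale` compensates the smallness of the step size. -/
theorem five_le_sampleScale_mul (hcard : 2 ≤ Fintype.card 𝒮 * Fintype.card 𝒜)
    (hΛ : 0 < minOcc b μ) (hη1 : eta M b μ ≤ 1 / 2) (hτ : 1 ≤ maxHitting M b y₀) {r ε : ℝ}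
    (hr : 0 < r) (hε : 0 < ε) :
    5 ≤ eta M b μ * accStep M b μ y₀ r ε / 2 * (10 ^ 6 * sampleScale M b μ y₀ r ε) := by
  have hη := eta_pos (M := M) hΛ
  have hρ := ten_le_rho1 (y₀ := y₀) hcard hη hη1 hτ
  have hup := (rho1_bounds (y₀ := y₀) hcard hη hη1 hτ).2
  have hn := two_le_numPairs hcard
  have hl : 0 < Real.log (numPairs 𝒮 𝒜) := Real.log_pos (by linarith)
  have hγ : 0 < 1 - M.disc := by linarith [M.disc_lt_one]
  have he := Real.exp_one_lt_d9
  rw [le_div_iff₀ hη] at hup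
  unfold accStep sampleScale
  set ρ := rho1 M b μ y₀
  set τ := maxHitting M b y₀
  set ℓ := Real.log (numPairs 𝒮 𝒜)
  have hρ0 : 0 < ρ := by linarith
  -- Origin of the exponents: `η²` from rate and step size and one more `η` from `ϱ_{Q,1}` give `(1
  -- - γ)³ Λ_min³`; the bound on `‖Q*‖²` gives the remaining `(1 - γ)²`.
  have e : eta M b μ * (ε ^ 2 * eta M b μ * (1 - M.disc) ^ 2 / (1044 * r ^ 2 * ρ)) / 2 *
      (10 ^ 6 * (r ^ 2 * τ * ℓ / (ε ^ 2 * (1 - M.disc) ^ 5 * minOcc b μ ^ 3))) =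
      10 ^ 6 * (τ * ℓ) / (2088 * (ρ * eta M b μ)) := by
    unfold eta
    field_simp
    ring
  rw [e, le_div_iff₀ (by positivity)]
  have h1 : ρ * eta M b μ ≤ 16 * 2.7182818286 * (τ * ℓ) := by
    have := mul_le_mul_of_nonneg_right he.le (by positivity : 0 ≤ τ * ℓ)
    linarith
  have h2 : 0 < τ * ℓ := mul_pos (by linarith) hl
  linarith

/-- It suffices to reach `ε³`, since `ε ≤ 1/2`. The prefactor is cancelled by `log (1 + ρ)` in one
case and by a single power of `ε` in the other. -/
theorem mul_exp_neg_five_mul_le {ρ ε x : ℝ} (hρ : 0 ≤ ρ) (hε : 0 < ε) (hε1 : ε ≤ 1 / 2)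
    (hx : 5 * (Real.log (1 / ε) + Real.log (1 + ρ)) ≤ x ∨
      (ε * ρ ≤ 1 ∧ 5 * Real.log (1 / ε) ≤ x)) :
    ρ * Real.exp (-x) ≤ ε ^ 2 / 2 := by
  have hlog : 0 ≤ Real.log (1 / ε) :=
    Real.log_nonneg (by rw [le_div_iff₀ hε]; linarith)
  have hexp : ∀ j : ℕ, Real.exp (-(j * Real.log (1 / ε))) = ε ^ j := by
    intro j
    rw [one_div, Real.log_inv, mul_neg, neg_neg, mul_comm, Real.exp_mul, Real.exp_log hε,
      Real.rpow_natCast]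
  have hε3 : ε ^ 3 ≤ ε ^ 2 / 2 := by nlinarith [sq_nonneg ε]
  refine le_trans ?_ hε3
  rcases hx with hx | ⟨h1, hx⟩
  · have hlog2 : 0 ≤ Real.log (1 + ρ) := Real.log_nonneg (by linarith)
    have hle : Real.exp (-x) ≤ ε ^ 3 / (1 + ρ) := by
      calc Real.exp (-x) ≤ Real.exp (-((3 : ℕ) * Real.log (1 / ε)) - Real.log (1 + ρ)) := by
            refine Real.exp_le_exp.2 ?_
            push_cast
            linarith
        _ = _ := by rw [Real.exp_sub, hexp, Real.exp_log (by linarith)]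
    calc ρ * Real.exp (-x) ≤ ρ * (ε ^ 3 / (1 + ρ)) := mul_le_mul_of_nonneg_left hle hρ
      _ = ε ^ 3 * (ρ / (1 + ρ)) := by ring
      _ ≤ ε ^ 3 := mul_le_of_le_one_right (by positivity)
          ((div_le_one (by linarith)).2 (by linarith))
  · have hle : Real.exp (-x) ≤ ε ^ 4 := by
      rw [← hexp 4]
      refine Real.exp_le_exp.2 ?_
      push_cast
      linarith
    calc ρ * Real.exp (-x) ≤ ρ * ε ^ 4 := mul_le_mul_of_nonneg_left hle hρ
      _ = (ε * ρ) * ε ^ 3 := by ring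
      _ ≤ ε ^ 3 := mul_le_of_le_one_left (by positivity) h1

theorem integral_err_sq_le_of_accStep (hcard : 2 ≤ Fintype.card 𝒮 * Fintype.card 𝒜)
    (hpos : ∀ s a, 0 < b.prob s a) (hirr : (stateChain M b).IsIrreducible)
    (htraj : IsTrajectory M b P S A) (Q₀ : 𝒮 × 𝒜 → ℝ) (hμ : IsStationary M b μ)
    {r ε : ℝ} (hr : 0 < r) (hR : ∀ s a, |M.reward s a| ≤ r) (hε : 0 < ε) (hε1 : ε ≤ 1 / 2)
    (hεr : ε * (1 - M.disc) ≤ r) {k : ℕ}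
    (hk : 10 ^ 6 * sampleScale M b μ y₀ r ε *
          (Real.log (1 / ε) + Real.log (1 + rho0 M b μ y₀ Q₀)) ≤ k ∨
        (ε * rho0 M b μ y₀ Q₀ ≤ 1 ∧
          10 ^ 6 * sampleScale M b μ y₀ r ε * Real.log (1 / ε) ≤ k)) :
    Integrable (fun ω => err M (fun _ => accStep M b μ y₀ r ε) Q₀ S A k ω ^ 2) P ∧
      ∫ ω, err M (fun _ => accStep M b μ y₀ r ε) Q₀ S A k ω ^ 2 ∂P ≤ ε ^ 2 ∧
      ∫ ω, err M (fun _ => accStep M b μ y₀ r ε) Q₀ S A k ω ∂P ≤ ε := by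
  have hΛ := minOcc_pos hpos hirr hμ
  have hη := eta_pos (M := M) hΛ
  have hη1 := eta_le_half hcard hμ hΛ
  have hτ := one_le_maxHitting (y₀ := y₀) hpos hirr hcard
  have hρ10 := ten_le_rho1 (y₀ := y₀) hcard hη hη1 hτ
  have hρ0 := (rho0_bounds (y₀ := y₀) Q₀ hη hη1 (by linarith)).1
  have hρ0' : 0 ≤ rho0 M b μ y₀ Q₀ := le_trans (by positivity) hρ0
  have hγ : 0 < 1 - M.disc := by linarith [M.disc_lt_one]
  have hα := accStep_pos hη (by linarith : 0 < rho1 M b μ y₀) hr hε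
  have hαle := (accStep_le hη hη1 hρ10 hr hε hεr).trans (min_le_right _ _)
  have h5 := five_le_sampleScale_mul (y₀ := y₀) hcard hΛ hη1 hτ hr hε
  obtain ⟨hint, hbound⟩ := integral_err_sq_le_of_const hcard hpos hirr htraj Q₀ hμ hα hαle k
  have hq : 0 ≤ eta M b μ * accStep M b μ y₀ r ε / 2 := by positivity
  have hlog : 0 ≤ Real.log (1 / ε) := Real.log_nonneg (by rw [le_div_iff₀ hε]; linarith)
  have hlog2 : 0 ≤ Real.log (1 + rho0 M b μ y₀ Q₀) := Real.log_nonneg (by linarith)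
  have hscale : ∀ ℓ : ℝ, 0 ≤ ℓ → 10 ^ 6 * sampleScale M b μ y₀ r ε * ℓ ≤ k →
      5 * ℓ ≤ eta M b μ * accStep M b μ y₀ r ε / 2 * k := by
    intro ℓ hℓ h
    calc 5 * ℓ ≤ eta M b μ * accStep M b μ y₀ r ε / 2 *
          (10 ^ 6 * sampleScale M b μ y₀ r ε) * ℓ := mul_le_mul_of_nonneg_right h5 hℓ
      _ = eta M b μ * accStep M b μ y₀ r ε / 2 *
          (10 ^ 6 * sampleScale M b μ y₀ r ε * ℓ) := by ring
      _ ≤ _ := mul_le_mul_of_nonneg_left h hq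
  have hexp := mul_exp_neg_five_mul_le (x := eta M b μ * accStep M b μ y₀ r ε / 2 * k) hρ0' hε hε1
    (hk.imp (hscale _ (by linarith)) fun h => ⟨h.1, hscale _ hlog h.2⟩)
  have hnoise : 58 * constB M * rho1 M b μ y₀ * accStep M b μ y₀ r ε / eta M b μ ≤ ε ^ 2 / 2 := by
    have hQ := norm_Qstar_le hr.le hR
    have hsq : ((1 - M.disc) * ‖Qstar M‖) ^ 2 ≤ r ^ 2 :=
      pow_le_pow_left₀ (by positivity) hQ 2
    have hρpos : 0 < rho1 M b μ y₀ := by linarith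
    -- The constant `1044 = 2 · 58 · 9` in the step size makes the noise floor exactly this share of
    -- `ε² / 2`.
    have e : 58 * constB M * rho1 M b μ y₀ * accStep M b μ y₀ r ε / eta M b μ =
        ε ^ 2 / 2 * (((1 - M.disc) * ‖Qstar M‖) ^ 2 / r ^ 2) := by
      unfold constB accStep
      field_simp
      ring
    rw [e]
    exact mul_le_of_le_one_right (by positivity) ((div_le_one (by positivity)).2 hsq)
  have hsqle : ∫ ω, err M (fun _ => accStep M b μ y₀ r ε) Q₀ S A k ω ^ 2 ∂P ≤ ε ^ 2 := by
    rw [show -eta M b μ * accStep M b μ y₀ r ε * k / 2 =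
      -(eta M b μ * accStep M b μ y₀ r ε / 2 * k) by ring] at hbound
    linarith
  refine ⟨hint, hsqle, ?_⟩
  have hint1 : Integrable (fun ω => err M (fun _ => accStep M b μ y₀ r ε) Q₀ S A k ω) P :=
    htraj.integrable_iterate _ Q₀ k fun Q _ => ‖Q - Qstar M‖
  -- First moment from second by `x ≤ x²/(2ε) + ε/2`, in place of Jensen's inequality.
  have hmono : ∫ ω, err M (fun _ => accStep M b μ y₀ r ε) Q₀ S A k ω ∂P ≤
      ∫ ω, (1 / (2 * ε) * err M (fun _ => accStep M b μ y₀ r ε) Q₀ S A k ω ^ 2 + ε / 2) ∂P := by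
    refine integral_mono hint1 ((hint.const_mul _).add (integrable_const _)) fun ω => ?_
    simp only
    generalize err M (fun _ => accStep M b μ y₀ r ε) Q₀ S A k ω = x
    have e : 1 / (2 * ε) * x ^ 2 + ε / 2 - x = (x - ε) ^ 2 / (2 * ε) := by
      field_simp
      ring
    have : 0 ≤ (x - ε) ^ 2 / (2 * ε) := by positivity
    linarith
  refine hmono.trans ?_
  rw [integral_add (hint.const_mul _) (integrable_const _), integral_const_mul]
  have h2 := mul_le_mul_of_nonneg_left hsqle (by positivity : 0 ≤ 1 / (2 * ε))
  have e : 1 / (2 * ε) * ε ^ 2 = ε / 2 := by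
    field_simp
  simp only [integral_const, probReal_univ, one_smul]
  linarith

end Main

end QLearn

/-! ### The main theorem -/

open QLearn

theorem theorem5 {𝒮 𝒜 : Type*} [Fintype 𝒮] [Fintype 𝒜] [DecidableEq 𝒮] [DecidableEq 𝒜]
    [Nonempty 𝒮] [Nonempty 𝒜] (hcard : 2 ≤ Fintype.card 𝒮 * Fintype.card 𝒜)
    (M : QLearn.FiniteMDP 𝒮 𝒜) (b : QLearn.Policy 𝒮 𝒜)
    (hpos : ∀ s a, 0 < b.prob s a) (hirr : (QLearn.stateChain M b).IsIrreducible)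
    {Ω : Type*} [MeasurableSpace Ω] (P : Measure Ω) [IsProbabilityMeasure P]
    (S : ℕ → Ω → 𝒮) (A : ℕ → Ω → 𝒜) (htraj : QLearn.IsTrajectory M b P S A)
    (Q₀ : 𝒮 × 𝒜 → ℝ) (y₀ : 𝒮 × 𝒜) :
    -- the constants are well defined
    (∃! μ : 𝒮 → ℝ, QLearn.IsStationary M b μ) ∧
    (∀ y, QLearn.expHitting M b y₀ y ≠ ⊤) ∧
    ∀ μ : 𝒮 → ℝ, QLearn.IsStationary M b μ →
      0 < QLearn.minOcc b μ ∧
      0 < QLearn.rho1 M b μ y₀ ∧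
      QLearn.rho1 M b μ y₀ ≤
        32 * Real.exp 1 * QLearn.maxHitting M b y₀ * Real.log (QLearn.numPairs 𝒮 𝒜) /
          ((1 - M.disc) * QLearn.minOcc b μ) ∧
      QLearn.rho0 M b μ y₀ Q₀ ≤
        4 * (1 + 50 * QLearn.rho1 M b μ y₀) * ‖Q₀ - QLearn.Qstar M‖ ^ 2 +
          36 * ‖QLearn.Qstar M‖ ^ 2 * QLearn.rho1 M b μ y₀ ∧
      -- constant step size
      (∀ α : ℝ, 0 < α →
        α ≤ min 1 (QLearn.eta M b μ /
          (QLearn.constA * (5 + 2 * QLearn.eta M b μ) * QLearn.rho1 M b μ y₀)) →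
        ∀ k : ℕ,
          Integrable (fun ω => QLearn.err M (fun _ => α) Q₀ S A (k + 1) ω ^ 2) P ∧
          ∫ ω, QLearn.err M (fun _ => α) Q₀ S A (k + 1) ω ^ 2 ∂P ≤
            QLearn.rho0 M b μ y₀ Q₀ * Real.exp (-QLearn.eta M b μ * α * k / 2) +
              58 * QLearn.constB M * QLearn.rho1 M b μ y₀ * α / QLearn.eta M b μ) ∧
      -- diminishing step size
      (∀ α K : ℝ, 2 / QLearn.eta M b μ < α →
        max (QLearn.constA * α * (5 * α + 8) * QLearn.rho1 M b μ y₀) 2 ≤ K →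
        ∀ k : ℕ,
          Integrable (fun ω => QLearn.err M (fun n => α / (n + K)) Q₀ S A (k + 1) ω ^ 2) P ∧
          ∫ ω, QLearn.err M (fun n => α / (n + K)) Q₀ S A (k + 1) ω ^ 2 ∂P ≤
            QLearn.rho0 M b μ y₀ Q₀ * (K / (k + K)) ^ (QLearn.eta M b μ * α / 2) +
              2 * QLearn.constB M * QLearn.rho1 M b μ y₀ * α / (k + K) +
              72 * QLearn.constB M * QLearn.rho1 M b μ y₀ * Real.exp 1 * α ^ 2 /
                ((QLearn.eta M b μ * α / 2 - 1) * (k + K))) ∧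
      -- sample complexity with a constant step size
      (∀ r ε : ℝ, 0 < r → (∀ s a, |M.reward s a| ≤ r) →
        0 < ε → ε ≤ 1 / 2 → ε * (1 - M.disc) ≤ r →
        0 < QLearn.accStep M b μ y₀ r ε ∧
        QLearn.accStep M b μ y₀ r ε ≤ min 1 (QLearn.eta M b μ /
          (QLearn.constA * (5 + 2 * QLearn.eta M b μ) * QLearn.rho1 M b μ y₀)) ∧
        ∀ k : ℕ,
          (10 ^ 6 * QLearn.sampleScale M b μ y₀ r ε *
              (Real.log (1 / ε) + Real.log (1 + QLearn.rho0 M b μ y₀ Q₀)) ≤ k ∨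
            (ε * QLearn.rho0 M b μ y₀ Q₀ ≤ 1 ∧
              10 ^ 6 * QLearn.sampleScale M b μ y₀ r ε * Real.log (1 / ε) ≤ k)) →
          Integrable (fun ω => QLearn.err M (fun _ => QLearn.accStep M b μ y₀ r ε) Q₀ S A k ω ^ 2)
            P ∧
          ∫ ω, QLearn.err M (fun _ => QLearn.accStep M b μ y₀ r ε) Q₀ S A k ω ^ 2 ∂P ≤ ε ^ 2 ∧
          ∫ ω, QLearn.err M (fun _ => QLearn.accStep M b μ y₀ r ε) Q₀ S A k ω ∂P ≤ ε) := by
  refine ⟨existsUnique_isStationary M b hirr, fun y => ?_, fun μ hμ => ?_⟩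
  · rw [expHitting_eq hpos hirr]
    exact ENNReal.ofReal_ne_top
  have hΛ := minOcc_pos hpos hirr hμ
  have hη := eta_pos (M := M) hΛ
  have hη1 := eta_le_half hcard hμ hΛ
  have hτ := one_le_maxHitting (y₀ := y₀) hpos hirr hcard
  have hρ10 := ten_le_rho1 (y₀ := y₀) hcard hη hη1 hτ
  have hρ : 0 < rho1 M b μ y₀ := by linarith
  have hρ0 : 0 ≤ rho0 M b μ y₀ Q₀ :=
    le_trans (by positivity) (rho0_bounds (y₀ := y₀) Q₀ hη hη1 hρ.le).1
  refine ⟨hΛ, hρ, ?_, (rho0_bounds Q₀ hη hη1 hρ.le).2, fun α hα hαle k => ?_,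
    fun α K hα hK k => ?_, fun r ε hr hR hε hε1 hεr => ⟨accStep_pos hη hρ hr hε,
      accStep_le hη hη1 hρ10 hr hε hεr, fun k hk =>
        integral_err_sq_le_of_accStep hcard hpos hirr htraj Q₀ hμ hr hR hε hε1 hεr hk⟩⟩
  · refine (rho1_bounds hcard hη hη1 hτ).2.trans ?_
    have hl : 0 ≤ Real.log (numPairs 𝒮 𝒜) :=
      Real.log_nonneg (by linarith [two_le_numPairs hcard])
    change _ ≤ _ / eta M b μ
    refine div_le_div_of_nonneg_right ?_ hη.le
    have : 0 ≤ Real.exp 1 * maxHitting M b y₀ * Real.log (numPairs 𝒮 𝒜) := by positivity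
    linarith
  -- The bound proved for index `k + 1` has `k + 1` in the exponent as well, so it is stronger than
  -- the one asked for.
  · obtain ⟨hint, hbound⟩ := integral_err_sq_le_of_const hcard hpos hirr htraj Q₀ hμ hα
      (hαle.trans (min_le_right _ _)) (k + 1)
    refine ⟨hint, hbound.trans (add_le_add_left (mul_le_mul_of_nonneg_left ?_ hρ0) _)⟩
    refine Real.exp_le_exp.2 ?_
    push_cast
    linarith [mul_pos hη hα]
  · obtain ⟨hint, hbound⟩ := integral_err_sq_le_of_dimin hcard hpos hirr htraj Q₀ hμ hα
      ((le_max_left _ _).trans hK) (k + 1)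
    refine ⟨hint, hbound.trans ?_⟩
    have hK0 : 0 < K := by linarith [(le_max_right _ _).trans hK]
    have hηα : 2 < α * eta M b μ := by rwa [div_lt_iff₀ hη] at hα
    have hα0 : 0 < α := lt_trans (by positivity) hα
    have hkK : 0 < (k : ℝ) + K := by positivity
    have hB : 0 ≤ constB M := by
      unfold constB
      positivity
    -- The Lyapunov recursion produces no such term; it enters only as nonnegative slack.
    have hmid : 0 ≤ 2 * constB M * rho1 M b μ y₀ * α / (k + K) := by positivity
    have h1 : (K / ((k + 1 : ℕ) + K)) ^ (eta M b μ * α / 2) ≤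
        (K / (k + K)) ^ (eta M b μ * α / 2) := by
      push_cast
      refine Real.rpow_le_rpow (by positivity) ?_ (by positivity)
      exact div_le_div_of_nonneg_left hK0.le hkK (by linarith)
    have h2 : 72 * constB M * rho1 M b μ y₀ * Real.exp 1 * α ^ 2 /
          ((eta M b μ * α / 2 - 1) * ((k + 1 : ℕ) + K)) ≤
        72 * constB M * rho1 M b μ y₀ * Real.exp 1 * α ^ 2 /
          ((eta M b μ * α / 2 - 1) * (k + K)) := by
      have ha : 0 < eta M b μ * α / 2 - 1 := by linarith
      push_cast
      refine div_le_div_of_nonneg_left (by positivity) (mul_pos ha hkK) ?_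
      exact mul_le_mul_of_nonneg_left (by linarith) ha.le
    have h3 := mul_le_mul_of_nonneg_left h1 hρ0
    linarith
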